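/- Let $k$ be a field. For a finite set $D=\{d_1,\dots,d_r\}$ of positive integers let $\langle D\rangle\subset\mathbb N$ be the semigroup (with $0$) generated by $D$, and let $k[D]=k[t^{d_1},\dots,t^{d_r}]\subset k[t]$ be its semigroup ring, a graded module over the polynomial ring in $r$ variables, where the $i$-th variable has weight $d_i$ and acts by multiplication by $t^{d_i}$. A graded free resolution (by finitely generated graded free modules) is minimal if the image of every differential lies in the ideal generated by the variables times its target. The Betti number $\beta_i(D)$ is the rank of the $i$-th module of a minimal graded free resolution of $k[D]$, with $\beta_i(D)=0$ for $i<0$. The Cohen–Macaulay type of $k[D]$, a ring of dimension $1$, is $\dim_k \operatorname{Ext}^1_{k[D]}(k,k[D])$, where $k=k[D]/(t^{d_1},\dots,t^{d_r})$. **Theorem.** Let $A=\{a_1,\dots,a_n\}$ be the minimal generating set ($n$ distinct elements) of a numerical semigroup, so $\gcd(a_1,\dots,a_n)=1$. Let $k_1,k_2$ be relatively prime positive integers with $k_1\in\langle A\rangle\setminus A$ and $k_2\neq 1$, and let $C=k_1\sqcup k_2A=\{k_1,k_2a_1,\dots,k_2a_n\}$ (a simple split). Write $R_A=k[x_1,\dots,x_n]$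 with $\deg x_i=a_i$, and $R=k[x_0,\dots,x_n]$ with $\deg x_0=k_1$ and $\deg x_i=k_2a_i$ for $i\ge1$. Then: 1. There are nonnegative integers $\alpha_1,\dots,\alpha_n$ with $k_1=\sum_i\alpha_ia_i$. For every choice of them let $\rho=x_0^{k_2}-x_1^{\alpha_1}\cdots x_n^{\alpha_n}\in R$, which is homogeneous of degree $k_1k_2$. For every minimal graded free resolution $F_A$ of $k[A]$ over $R_A$, the mapping cone of the multiplication by $\rho$ on $F_A\otimes_{R_A}R$ (with the degrees of $F_A$ multiplied by $k_2$, and those of the source of the multiplication map raised by $k_1k_2$) is a minimal graded free resolution of $k[C]$ over $R$. 2. Minimal graded free resolutions of $k[A]$ and of $k[C]$ exist, their ranks do not depend on the choice of the resolution, and $\beta_i(C)=\beta_i(A)+\beta_{i-1}(A)$ for all $i\in\mathbb Z$. 3. The Cohen–Macaulay type of $k[C]$ equals that of $k[A]$. -/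

import Mathlib

open scoped BigOperators
open MvPolynomial CategoryTheory

universe u

namespace SimpleSplit

/-! ### Semigroups and semigroup rings -/

/-- The family `a = (a₁, …, aₙ)` of pairwise distinct positive integers has greatest common divisor
`1` and no proper subset of `{a₁, …, aₙ}` generates the same semigroup: `a` enumerates the minimal
generating set of a numerical semigroup. -/
structure IsMinimalGenerators {n : ℕ} (a : Fin n → ℕ) : Prop where
  pos : ∀ i, 0 < a i
  injective : Function.Injective a
  gcd_eq_one : Finset.univ.gcd a = 1
  minimal : ∀ S : Set ℕ, S ⊂ Set.range a →
    AddSubmonoid.closure S ≠ AddSubmonoid.closure (Set.range a)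

/-- `C = k₁ ⊔ k₂A` is a simple split, where `A = {a₁, …, aₙ}`. -/
structure IsSimpleSplit {n : ℕ} (a : Fin n → ℕ) (k₁ k₂ : ℕ) : Prop where
  gens : IsMinimalGenerators a
  k₁_pos : 0 < k₁
  k₂_pos : 0 < k₂
  k₂_ne_one : k₂ ≠ 1
  coprime : Nat.Coprime k₁ k₂
  k₁_mem : k₁ ∈ AddSubmonoid.closure (Set.range a)
  k₁_notMem : k₁ ∉ Set.range a

/-- The family `(k₁, k₂a₁, …, k₂aₙ)` of the elements of `C = k₁ ⊔ k₂A`. -/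
def splitGens {n : ℕ} (a : Fin n → ℕ) (k₁ k₂ : ℕ) : Fin (n + 1) → ℕ :=
  Fin.cons k₁ (fun i => k₂ * a i)

section Ring

variable (k : Type u) [Field k] {n : ℕ} (w : Fin n → ℕ)

/-- The homomorphism `k[x₁, …, xₙ] → k[t]`, `xᵢ ↦ t ^ wᵢ`. -/
noncomputable def toricHom : MvPolynomial (Fin n) k →ₐ[k] Polynomial k :=
  aeval (fun i => (Polynomial.X : Polynomial k) ^ w i)

/-- The semigroup ring `k[t ^ w₁, …, t ^ wₙ] ⊆ k[t]`, the image of `toricHom`. -/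
def SemigroupRing : Type u := (toricHom k w).range

noncomputable instance : CommRing (SemigroupRing k w) :=
  inferInstanceAs (CommRing (toricHom k w).range)

noncomputable instance : Algebra k (SemigroupRing k w) :=
  inferInstanceAs (Algebra k (toricHom k w).range)

/-- The inclusion of the semigroup ring in `k[t]`. -/
noncomputable def SemigroupRing.incl : SemigroupRing k w →ₐ[k] Polynomial k :=
  (toricHom k w).range.val

/-- The surjection `k[x₁, …, xₙ] → k[t ^ w₁, …, t ^ wₙ]`, `xᵢ ↦ t ^ wᵢ`. -/
noncomputable def toSemigroupRing : MvPolynomial (Fin n) k →ₐ[k] SemigroupRing k w :=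
  (toricHom k w).rangeRestrict

/-- The semigroup ring as an algebra (hence a module) over `k[x₁, …, xₙ]`. -/
noncomputable instance : Algebra (MvPolynomial (Fin n) k) (SemigroupRing k w) :=
  (toSemigroupRing k w).toRingHom.toAlgebra

/-- The ideal of the semigroup ring generated by `t ^ w₁, …, t ^ wₙ`: the homogeneous maximal
ideal when the `wᵢ` are positive. -/
noncomputable def maxIdeal : Ideal (SemigroupRing k w) :=
  Ideal.span (Set.range fun i => toSemigroupRing k w (X i))

/-- The Cohen–Macaulay type of the semigroup ring `S` of a numerical semigroup: `dim_k Ext¹_S(k, S)`,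
where `k = S / 𝔪` for the homogeneous maximal ideal `𝔪`. (The type of a Cohen–Macaulay ring of
dimension `d` is `dim_k Ext^d_S(k, S)`, and `S` has dimension `1`.) -/
noncomputable def cmType : ℕ :=
  Module.finrank k
    (Abelian.Ext.{u} (ModuleCat.of.{u} (SemigroupRing k w) (SemigroupRing k w ⧸ maxIdeal k w))
      (ModuleCat.of.{u} (SemigroupRing k w) (SemigroupRing k w)) 1)

end Ring

/-! ### Complexes of finitely generated graded free modules -/

/-- The polynomial `p` is homogeneous of degree `e` when `xᵢ` has weight `wᵢ`
(and `0` is homogeneous of every degree). -/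
abbrev IsHomog {k : Type u} [Field k] {n : ℕ} (w : Fin n → ℕ)
    (p : MvPolynomial (Fin n) k) (e : ℤ) : Prop :=
  IsWeightedHomogeneous (fun i => (w i : ℤ)) p e

/-- A complex `⋯ → F₂ → F₁ → F₀` of finitely generated graded free modules over `R = k[x₁, …, xₙ]`
with `deg xᵢ = wᵢ`. Here `Fᵢ = R ^ (ι i)`, the basis element with index `j` has degree `deg i j`,
and the degree-preserving differential `Fᵢ₊₁ → Fᵢ` is given by the matrix `d i`. -/
structure GradedFreeComplex (k : Type u) [Field k] {n : ℕ} (w : Fin n → ℕ) where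
  ι : ℕ → Type
  fin : ∀ i, Fintype (ι i)
  dec : ∀ i, DecidableEq (ι i)
  deg : ∀ i, ι i → ℤ
  d : ∀ i, Matrix (ι i) (ι (i + 1)) (MvPolynomial (Fin n) k)
  d_homog : ∀ i l j, IsHomog w (d i l j) (deg (i + 1) j - deg i l)
  d_comp_d : ∀ i, d i * d (i + 1) = 0

namespace GradedFreeComplex

attribute [instance] GradedFreeComplex.fin GradedFreeComplex.dec

variable {k : Type u} [Field k] {n m : ℕ} {w : Fin n → ℕ}

/-- The rank of the `i`-th module of the complex, zero for `i < 0`. -/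
def rank (F : GradedFreeComplex k w) : ℤ → ℕ
  | Int.ofNat i => Fintype.card (F.ι i)
  | Int.negSucc _ => 0

/-- `F` is a minimal graded free resolution of the semigroup ring `k[t ^ w₁, …, t ^ wₙ]`. -/
structure IsMinimalResolution (F : GradedFreeComplex k w) : Prop where
  /-- exactness in positive homological degrees -/
  exact : ∀ i, Function.Exact (F.d (i + 1)).mulVecLin (F.d i).mulVecLin
  /-- there is a degree-preserving surjection `ε` from `F₀` to the semigroup ring whose kernel is
  the image of `F₁` -/
  augmentation : ∃ ε : (F.ι 0 → MvPolynomial (Fin n) k) →ₗ[MvPolynomial (Fin n) k]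
      SemigroupRing k w,
    Function.Surjective ε ∧ Function.Exact (F.d 0).mulVecLin ε ∧
    ∀ (l : F.ι 0) (e : ℕ), (e : ℤ) ≠ F.deg 0 l →
      (SemigroupRing.incl k w (ε (Pi.single l 1))).coeff e = 0
  /-- the image of each differential lies in `(x₁, …, xₙ)` times its target -/
  minimal : ∀ i l j, F.d i l j ∈
    Ideal.span (Set.range (X : Fin n → MvPolynomial (Fin n) k))

/-- A morphism of complexes `F → G` that raises degrees by `s`. -/
structure Hom (F G : GradedFreeComplex k w) (s : ℤ) where
  f : ∀ i, Matrix (G.ι i) (F.ι i) (MvPolynomial (Fin n) k)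
  f_homog : ∀ i l j, IsHomog w (f i l j) (F.deg i j + s - G.deg i l)
  comm : ∀ i, G.d i * f (i + 1) = f i * F.d i

/-- Multiplication by a homogeneous element `ρ` of degree `s` as an endomorphism of a complex. -/
noncomputable def mulHom (F : GradedFreeComplex k w) (ρ : MvPolynomial (Fin n) k) (s : ℤ)
    (hρ : IsHomog w ρ s) : Hom F F s where
  f _ := ρ • (1 : Matrix _ _ _)
  f_homog i l j := by
    by_cases h : l = j
    · subst h
      simpa using hρ
    · simpa [Matrix.one_apply_ne h] using isWeightedHomogeneous_zero k _ _
  comm i := by simp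

/-- The index sets of the mapping cone: `Gᵢ ⊕ Fᵢ₋₁`. -/
def coneι (F G : GradedFreeComplex k w) : ℕ → Type
  | 0 => G.ι 0
  | i + 1 => G.ι (i + 1) ⊕ F.ι i

/-- The mapping cone of `φ : F → G`. Its `i`-th module is `Gᵢ ⊕ Fᵢ₋₁` and its differential sends
`(g, f)` to `(∂g + φ f, -∂f)`. The degrees of the basis elements of `F` are raised by the
degree `s` of `φ`. -/
noncomputable def cone {F G : GradedFreeComplex k w} {s : ℤ} (φ : Hom F G s) :
    GradedFreeComplex k w where
  ι := coneι F G
  fin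
    | 0 => G.fin 0
    | i + 1 => inferInstanceAs (Fintype (G.ι (i + 1) ⊕ F.ι i))
  dec
    | 0 => G.dec 0
    | i + 1 => inferInstanceAs (DecidableEq (G.ι (i + 1) ⊕ F.ι i))
  deg
    | 0 => G.deg 0
    | i + 1 => Sum.elim (G.deg (i + 1)) (fun j => F.deg i j + s)
  d
    | 0 => Matrix.fromCols (G.d 0) (φ.f 0)
    | i + 1 => Matrix.fromBlocks (G.d (i + 1)) (φ.f (i + 1)) 0 (-(F.d i))
  d_homog
    | 0, l, Sum.inl j => G.d_homog 0 l j
    | 0, l, Sum.inr j => φ.f_homog 0 l j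
    | i + 1, Sum.inl l, Sum.inl j => G.d_homog (i + 1) l j
    | i + 1, Sum.inl l, Sum.inr j => φ.f_homog (i + 1) l j
    | i + 1, Sum.inr l, Sum.inl j => isWeightedHomogeneous_zero k _ _
    | i + 1, Sum.inr l, Sum.inr j => by
      have h := (weightedHomogeneousSubmodule k (fun i => (w i : ℤ)) _).neg_mem
        (F.d_homog i l j)
      have e : F.deg (i + 1) j + s - (F.deg i l + s) = F.deg (i + 1) j - F.deg i l := by ring
      change IsHomog w (-(F.d i l j)) (F.deg (i + 1) j + s - (F.deg i l + s))
      rw [e]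
      exact h
  d_comp_d
    | 0 => by
      change Matrix.fromCols (G.d 0) (φ.f 0) *
        Matrix.fromBlocks (G.d 1) (φ.f 1) 0 (-(F.d 0)) = 0
      rw [Matrix.fromCols_mul_fromBlocks, G.d_comp_d, φ.comm]
      simp
    | i + 1 => by
      change Matrix.fromBlocks (G.d (i + 1)) (φ.f (i + 1)) 0 (-(F.d i)) *
        Matrix.fromBlocks (G.d (i + 2)) (φ.f (i + 2)) 0 (-(F.d (i + 1))) = 0
      rw [Matrix.fromBlocks_multiply, G.d_comp_d, φ.comm]
      simp [F.d_comp_d]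

/-- Renaming the variables along `σ`, where `w'_{σ i} = s wᵢ`, multiplies degrees by `s`. -/
theorem isHomog_rename {w' : Fin m → ℕ} (σ : Fin n → Fin m) (s : ℕ)
    (h : ∀ i, w' (σ i) = s * w i) {p : MvPolynomial (Fin n) k} {e : ℤ} (hp : IsHomog w p e) :
    IsHomog w' (rename σ p) (s * e) := by
  intro q hq
  obtain ⟨u, rfl, hu⟩ := coeff_rename_ne_zero σ p q hq
  rw [← hp hu]
  simp only [Finsupp.weight_apply]
  rw [Finsupp.sum_mapDomain_index (by simp) (by intros; simp [add_mul])]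
  simp only [Finsupp.sum, Finset.mul_sum, h]
  refine Finset.sum_congr rfl fun i _ => ?_
  simp only [nsmul_eq_mul]
  push_cast
  ring

/-- The complex `F ⊗ k[x₁, …, xₘ]` obtained by extending scalars along `xᵢ ↦ x_{σ i}`, where
`w'_{σ i} = s wᵢ`: the matrices stay the same up to the renaming of the variables, and all degrees
are multiplied by `s`. -/
noncomputable def extend (F : GradedFreeComplex k w) {w' : Fin m → ℕ} (σ : Fin n → Fin m) (s : ℕ)
    (h : ∀ i, w' (σ i) = s * w i) : GradedFreeComplex k w' where
  ι := F.ι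
  fin := F.fin
  dec := F.dec
  deg i j := s * F.deg i j
  d i := (F.d i).map (rename σ)
  d_homog i l j := by
    rw [← mul_sub]
    exact isHomog_rename σ s h (F.d_homog i l j)
  d_comp_d i := by
    rw [← Matrix.map_mul, F.d_comp_d]
    exact Matrix.map_zero _ (map_zero _)

end GradedFreeComplex

/-- `β i` (`i ∈ ℤ`) are the Betti numbers of the semigroup ring `k[t ^ w₁, …, t ^ wₙ]`: minimal
graded free resolutions exist, and in each of them the `i`-th module has rank `β i`
(zero for `i < 0`). -/
def HasBettiNumbers (k : Type u) [Field k] {n : ℕ} (w : Fin n → ℕ) (β : ℤ → ℕ) : Prop :=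
  (∃ F : GradedFreeComplex k w, F.IsMinimalResolution) ∧
    ∀ F : GradedFreeComplex k w, F.IsMinimalResolution → ∀ i, F.rank i = β i

/-- The binomial `ρ = x₀ ^ k₂ - x₁ ^ α₁ ⋯ xₙ ^ αₙ`. -/
noncomputable def rho (k : Type u) [Field k] {n : ℕ} (k₂ : ℕ) (α : Fin n → ℕ) :
    MvPolynomial (Fin (n + 1)) k :=
  X 0 ^ k₂ - ∏ i, X i.succ ^ α i

theorem rho_homog (k : Type u) [Field k] {n : ℕ} (a : Fin n → ℕ) (k₁ k₂ : ℕ) (α : Fin n → ℕ)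
    (hα : k₁ = ∑ i, α i * a i) :
    IsHomog (splitGens a k₁ k₂) (rho k k₂ α) ((k₁ * k₂ : ℕ) : ℤ) := by
  refine (weightedHomogeneousSubmodule k
    (fun i => (splitGens a k₁ k₂ i : ℤ)) _).sub_mem ?_ ?_
  · have h := (isWeightedHomogeneous_X k (fun i => (splitGens a k₁ k₂ i : ℤ)) 0).pow k₂
    have e : k₂ • (splitGens a k₁ k₂ 0 : ℤ) = ((k₁ * k₂ : ℕ) : ℤ) := by
      simp [splitGens, mul_comm]
    rw [e] at h
    exact h
  · have h := IsWeightedHomogeneous.prod (R := k) Finset.univ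
      (fun i : Fin n => (X i.succ : MvPolynomial (Fin (n + 1)) k) ^ α i)
      (fun i => α i • (splitGens a k₁ k₂ i.succ : ℤ))
      (w := fun i => (splitGens a k₁ k₂ i : ℤ))
      (fun i _ => (isWeightedHomogeneous_X k _ _).pow _)
    have e : ∑ i, α i • (splitGens a k₁ k₂ i.succ : ℤ) = ((k₁ * k₂ : ℕ) : ℤ) := by
      rw [hα, Finset.sum_mul]
      push_cast
      refine Finset.sum_congr rfl fun i _ => ?_
      simp [splitGens]
      ring
    rw [e] at h
    exact h

/-- For a complex `F` over `k[x₁, …, xₙ]`, the mapping cone of the multiplication by `ρ` on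
`F ⊗ k[x₀, …, xₙ]`, where `deg x₀ = k₁` and `deg xᵢ = k₂aᵢ`. -/
noncomputable def splitCone {k : Type u} [Field k] {n : ℕ} {a : Fin n → ℕ}
    (F : GradedFreeComplex k a) (k₁ k₂ : ℕ) (α : Fin n → ℕ) (hα : k₁ = ∑ i, α i * a i) :
    GradedFreeComplex k (splitGens a k₁ k₂) :=
  GradedFreeComplex.cone
    ((F.extend (w' := splitGens a k₁ k₂) Fin.succ k₂ (fun i => by simp [splitGens])).mulHom
      (rho k k₂ α) _ (rho_homog k a k₁ k₂ α hα))

end SimpleSplit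

/-! Resolutions. Write `R = R_A[x₀]`. Substituting `t ^ k₂` for `t` and `t ^ k₁` for `x₀` maps
`k[A][x₀]` onto `k[C]`. The kernel is generated by the image of `ρ`, which is `x₀ ^ k₂ - t ^ k₁`,
monic in `x₀`: after division, a remainder `∑ sⱼ x₀ ^ j` with `j < k₂` cannot cancel, because `k₁`
is invertible modulo `k₂` and its terms have exponents in distinct residue classes
(`eq_zero_of_splitHom_eq_zero`). So `k[C] = k[A][x₀] / (ρ)` with `ρ` a nonzerodivisor. Since `F_A ⊗
R` resolves `k[A][x₀]`, the cone of `ρ` resolves `k[C]`; it is minimal because `ρ` has no constant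
term (`isMinimalResolution_splitCone`).

Betti numbers. Minimal resolutions are built by iterating minimal homogeneous generators of
syzygies. Two of them have equal ranks, since comparison maps compose to the identity modulo the
variables (`IsMinimalResolution.card_le`). The recursion for the Betti numbers is then read off the
cone.

Type. For a monomial nonzerodivisor `x` in the maximal ideal of `S`, `Ext¹(k, S)` is `Hom(k, S /
(x))`, the socle of `S / (x)`, which has a basis of monomials (`cmType_eq_card_socleExponents`).
With `x = t ^ aᵢ` for `A` and `x = t ^ (k₂aᵢ)` for `C`, the socle exponents correspond under `m ↦
k₂m + k₁(k₂ - 1)` (`bijOn_socleExponents`). -/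

namespace SimpleSplit

/-! ### Comparison of minimal resolutions -/

section Lifting

variable {R ι κ μ ν : Type*} [CommRing R]

theorem exists_matrix_mul_eq [Fintype κ] [DecidableEq κ] [Fintype μ]
    {A : Matrix ι κ R} {D : Matrix ι μ R}
    (h : LinearMap.range A.mulVecLin ≤ LinearMap.range D.mulVecLin) :
    ∃ B : Matrix μ κ R, D * B = A := by
  have h' : ∀ j, ∃ v, D.mulVec v = A.mulVec (Pi.single j 1) := fun j =>
    h ⟨Pi.single j 1, rfl⟩
  choose v hv using h'
  refine ⟨Matrix.of fun i j => v j i, ?_⟩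
  ext i j
  have := congrFun (hv j) i
  simp only [Matrix.mulVec_single_one, Matrix.col_apply] at this
  rw [← this]
  rfl

theorem range_mulVecLin_le_of_mul_eq_zero [Fintype κ] [Fintype μ] [Fintype ν]
    {D : Matrix ι κ R} {D' : Matrix κ μ R} {A : Matrix κ ν R}
    (hD : Function.Exact D'.mulVecLin D.mulVecLin) (h : D * A = 0) :
    LinearMap.range A.mulVecLin ≤ LinearMap.range D'.mulVecLin := by
  rintro _ ⟨v, rfl⟩
  refine (hD _).1 ?_
  rw [← LinearMap.comp_apply, ← Matrix.mulVecLin_mul, h]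
  simp

end Lifting

theorem mem_span_range_X_iff {k σ : Type*} [Field k] {p : MvPolynomial σ k} :
    p ∈ Ideal.span (Set.range (X : σ → MvPolynomial σ k)) ↔ constantCoeff p = 0 := by
  rw [← Set.image_univ, mem_ideal_span_X_image]
  constructor
  · intro h
    by_contra h0
    obtain ⟨i, -, hi⟩ := h 0 (by simpa [constantCoeff_eq] using h0)
    simp at hi
  · intro h m hm
    have : m ≠ 0 := by
      rintro rfl
      exact (mem_support_iff.1 hm) h
    obtain ⟨i, hi⟩ := Finsupp.ne_iff.1 this
    exact ⟨i, trivial, hi⟩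

namespace GradedFreeComplex

variable {k : Type u} [Field k] {n : ℕ} {w : Fin n → ℕ}

theorem IsMinimalResolution.map_constantCoeff {F : GradedFreeComplex k w}
    (hF : F.IsMinimalResolution) (i : ℕ) : (F.d i).map constantCoeff = 0 := by
  ext l j
  simpa using mem_span_range_X_iff.1 (hF.minimal i l j)

/-- Matrices `Φ : Fᵢ → F'ᵢ` and `G : F'ᵢ → Fᵢ` compatible with the differentials whose composite
is homotopic to the identity, with minimality built in. -/
theorem IsMinimalResolution.exists_comparison {F F' : GradedFreeComplex k w}
    (hF : F.IsMinimalResolution) (hF' : F'.IsMinimalResolution) (i : ℕ) :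
    ∃ (Φ : Matrix (F'.ι i) (F.ι i) (MvPolynomial (Fin n) k))
      (G : Matrix (F.ι i) (F'.ι i) (MvPolynomial (Fin n) k))
      (H : Matrix (F.ι (i + 1)) (F.ι i) (MvPolynomial (Fin n) k))
      (K : Matrix (F.ι i) (F.ι i) (MvPolynomial (Fin n) k)),
      G * Φ = 1 + F.d i * H + K ∧ K * F.d i = 0 ∧ K.map constantCoeff = 0 ∧
      LinearMap.range (Φ * F.d i).mulVecLin ≤ LinearMap.range (F'.d i).mulVecLin ∧
      LinearMap.range (G * F'.d i).mulVecLin ≤ LinearMap.range (F.d i).mulVecLin := by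
  induction i with
  | zero =>
    have key : ∀ {F F' : GradedFreeComplex k w}
        {ε : (F.ι 0 → MvPolynomial (Fin n) k) →ₗ[MvPolynomial (Fin n) k] SemigroupRing k w}
        {ε' : (F'.ι 0 → MvPolynomial (Fin n) k) →ₗ[MvPolynomial (Fin n) k] SemigroupRing k w}
        (_ : Function.Surjective ε'), ∃ Φ : Matrix (F'.ι 0) (F.ι 0) (MvPolynomial (Fin n) k),
          ∀ v, ε' (Φ.mulVec v) = ε v := by
      intro F F' ε ε' hε'
      obtain ⟨f, hf⟩ := Module.projective_lifting_property ε' ε hε'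
      refine ⟨LinearMap.toMatrix' f, fun v => ?_⟩
      rw [LinearMap.toMatrix'_mulVec, ← hf]
      rfl
    obtain ⟨ε, hs, he, -⟩ := hF.augmentation
    obtain ⟨ε', hs', he', -⟩ := hF'.augmentation
    obtain ⟨Φ, hΦ⟩ := key (F := F) (F' := F') (ε := ε) hs'
    obtain ⟨G, hG⟩ := key (F := F') (F' := F) (ε := ε') hs
    obtain ⟨H, hH⟩ := exists_matrix_mul_eq (A := G * Φ - 1) (D := F.d 0) (by
      rintro _ ⟨v, rfl⟩
      refine (he _).1 ?_
      rw [Matrix.mulVecLin_apply, Matrix.sub_mulVec, ← Matrix.mulVec_mulVec, map_sub, hG, hΦ,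
        Matrix.one_mulVec, sub_self])
    -- `K = 0` in degree zero: `G * Φ` and the identity agree after `ε`, so they differ by
    -- boundaries alone.
    refine ⟨Φ, G, H, 0, by rw [hH]; simp, by simp, by simp, ?_, ?_⟩
    · rintro _ ⟨v, rfl⟩
      refine (he' _).1 ?_
      rw [Matrix.mulVecLin_apply, ← Matrix.mulVec_mulVec, hΦ]
      exact (he _).2 ⟨v, rfl⟩
    · rintro _ ⟨v, rfl⟩
      refine (he _).1 ?_
      rw [Matrix.mulVecLin_apply, ← Matrix.mulVec_mulVec, hG]
      exact (he' _).2 ⟨v, rfl⟩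
  | succ i ih =>
    obtain ⟨Φ, G, H, K, h1, h2, h3, h4, h5⟩ := ih
    obtain ⟨Φ', hΦ'⟩ := exists_matrix_mul_eq h4
    obtain ⟨G', hG'⟩ := exists_matrix_mul_eq h5
    obtain ⟨H', hH'⟩ := exists_matrix_mul_eq (A := G' * Φ' - 1 - H * F.d i) (D := F.d (i + 1)) (by
      refine range_mulVecLin_le_of_mul_eq_zero (hF.exact i) ?_
      have e : F.d i * (G' * Φ') = F.d i + F.d i * H * F.d i := by
        rw [← Matrix.mul_assoc, hG', Matrix.mul_assoc, hΦ', ← Matrix.mul_assoc, h1]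
        simp [Matrix.add_mul, h2]
      rw [Matrix.mul_sub, Matrix.mul_sub, e, ← Matrix.mul_assoc]
      simp)
    -- The new `K` is the other half `H * F.d i` of the homotopy; minimality of `F` removes its
    -- constant terms.
    refine ⟨Φ', G', H', H * F.d i, by rw [hH']; abel, ?_, ?_, ?_, ?_⟩
    · rw [Matrix.mul_assoc, F.d_comp_d, Matrix.mul_zero]
    · rw [Matrix.map_mul, hF.map_constantCoeff, Matrix.mul_zero]
    · refine range_mulVecLin_le_of_mul_eq_zero (hF'.exact i) ?_
      rw [← Matrix.mul_assoc, hΦ', Matrix.mul_assoc, F.d_comp_d, Matrix.mul_zero]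
    · refine range_mulVecLin_le_of_mul_eq_zero (hF.exact i) ?_
      rw [← Matrix.mul_assoc, hG', Matrix.mul_assoc, F'.d_comp_d, Matrix.mul_zero]

/-- Setting the variables to zero kills `F.d i` and `K`, leaving `G * Φ = 1` over `k`; so the
identity of `Fᵢ ⊗ k` factors through `F'ᵢ ⊗ k`. -/
theorem IsMinimalResolution.card_le {F F' : GradedFreeComplex k w}
    (hF : F.IsMinimalResolution) (hF' : F'.IsMinimalResolution) (i : ℕ) :
    Fintype.card (F.ι i) ≤ Fintype.card (F'.ι i) := by
  obtain ⟨Φ, G, H, K, h1, -, h3, -⟩ := hF.exists_comparison hF' i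
  have h := congrArg (fun M => M.map constantCoeff) h1
  simp only [Matrix.map_mul, Matrix.map_add constantCoeff (map_add _), hF.map_constantCoeff, h3,
    Matrix.zero_mul, add_zero, Matrix.map_one constantCoeff (map_zero _) (map_one _)] at h
  have h' := Matrix.rank_mul_le_left (G.map constantCoeff) (Φ.map constantCoeff)
  rw [h, Matrix.rank_one] at h'
  exact h'.trans (Matrix.rank_le_card_width _)

theorem IsMinimalResolution.rank_eq {F F' : GradedFreeComplex k w}
    (hF : F.IsMinimalResolution) (hF' : F'.IsMinimalResolution) : F.rank = F'.rank := by
  funext i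
  cases i with
  | ofNat i => exact le_antisymm (hF.card_le hF' i) (hF'.card_le hF i)
  | negSucc i => rfl

end GradedFreeComplex

/-! ### Existence of minimal graded free resolutions -/

variable {k : Type u} [Field k] {n : ℕ} {w : Fin n → ℕ}

theorem weight_natCast (w : Fin n → ℕ) (m : Fin n →₀ ℕ) :
    Finsupp.weight (fun i => (w i : ℤ)) m = (Finsupp.weight w m : ℕ) := by
  simp [Finsupp.weight_apply, Finsupp.sum]

theorem toricHom_monomial (m : Fin n →₀ ℕ) (c : k) :
    toricHom k w (monomial m c) = Polynomial.monomial (Finsupp.weight w m) c := by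
  rw [toricHom, aeval_monomial, Finsupp.weight_apply, ← Polynomial.C_mul_X_pow_eq_monomial]
  simp [Finsupp.prod, Finsupp.sum, ← pow_mul, Finset.prod_pow_eq_pow_sum, mul_comm]

theorem coeff_toricHom_weightedHomogeneousComponent (p : MvPolynomial (Fin n) k) (e : ℤ) (f : ℕ) :
    (toricHom k w (weightedHomogeneousComponent (fun i => (w i : ℤ)) e p)).coeff f =
      if (f : ℤ) = e then (toricHom k w p).coeff f else 0 := by
  induction p using MvPolynomial.induction_on' with
  | monomial m c =>
    have h1 : weightedHomogeneousComponent (fun i => (w i : ℤ)) e (monomial m c) =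
        if (Finsupp.weight w m : ℤ) = e then monomial m c else 0 := by
      ext d
      rw [coeff_weightedHomogeneousComponent, weight_natCast, coeff_monomial]
      by_cases hd : m = d
      · subst hd
        split_ifs <;> simp_all
      · split_ifs <;> simp [coeff_monomial, hd]
    rw [h1, toricHom_monomial, Polynomial.coeff_monomial]
    by_cases hf : Finsupp.weight w m = f
    · subst hf
      split_ifs <;> simp_all [toricHom_monomial]
    · split_ifs <;> simp [toricHom_monomial, Polynomial.coeff_monomial, hf]
  | add p q hp hq =>
    simp only [map_add, Polynomial.coeff_add, hp, hq]
    split_ifs <;> simp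

/-- A nonzero constant term forces degree zero, and with positive weights the only monomial of
weight zero is `1`. This takes the place of the graded Nakayama lemma. -/
theorem IsHomog.eq_C (hw : ∀ i, 0 < w i) {p : MvPolynomial (Fin n) k} {e : ℤ}
    (hp : IsHomog w p e) (h : constantCoeff p ≠ 0) : p = C (constantCoeff p) := by
  have he : e = 0 := by simpa using (hp h).symm
  ext m
  rw [coeff_C]
  split_ifs with hm
  · rw [← hm]; rfl
  · by_contra hc
    have h1 := hp hc
    rw [he, weight_natCast] at h1
    refine hm (Eq.symm ?_)
    have h2 : Finsupp.weight w m = 0 := by exact_mod_cast h1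
    ext i
    by_contra hi
    simp only [Finsupp.weight_apply, Finsupp.sum, Finset.sum_eq_zero_iff, smul_eq_mul,
      mul_eq_zero] at h2
    rcases h2 i (Finsupp.mem_support_iff.2 hi) with h | h
    · exact hi h
    · exact (hw i).ne' h

theorem weightedHomogeneousComponent_add_mul {p q : MvPolynomial (Fin n) k} {a : ℤ}
    (hp : IsHomog w p a) (b : ℤ) :
    weightedHomogeneousComponent (fun i => (w i : ℤ)) (a + b) (p * q) =
      p * weightedHomogeneousComponent (fun i => (w i : ℤ)) b q := by
  ext m
  rw [coeff_weightedHomogeneousComponent, coeff_mul, coeff_mul,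
    ← Finset.sum_const_zero (s := Finset.HasAntidiagonal.antidiagonal m),
    ← Finset.sum_ite_irrel]
  refine Finset.sum_congr rfl ?_
  rintro ⟨x, y⟩ hxy
  rw [Finset.HasAntidiagonal.mem_antidiagonal] at hxy
  rw [coeff_weightedHomogeneousComponent, ← hxy, map_add]
  by_cases hx : coeff x p = 0
  · simp [hx]
  · simp [hp hx]

/-- The vector `v` is homogeneous of degree `e` when the `l`-th basis vector has degree `deg l`. -/
def IsHomogVec (w : Fin n → ℕ) {ι : Type} (deg : ι → ℤ) (v : ι → MvPolynomial (Fin n) k)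
    (e : ℤ) : Prop :=
  ∀ l, IsHomog w (v l) (e - deg l)

/-- The component of degree `e` of a vector. -/
noncomputable def homogVecComponent (w : Fin n → ℕ) {ι : Type} (deg : ι → ℤ) (e : ℤ)
    (v : ι → MvPolynomial (Fin n) k) : ι → MvPolynomial (Fin n) k :=
  fun l => weightedHomogeneousComponent (fun i => (w i : ℤ)) (e - deg l) (v l)

theorem isHomogVec_homogVecComponent {ι : Type} (deg : ι → ℤ) (e : ℤ)
    (v : ι → MvPolynomial (Fin n) k) : IsHomogVec w deg (homogVecComponent w deg e v) e :=
  fun _ => weightedHomogeneousComponent_isWeightedHomogeneous _ _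

theorem exists_sum_homogVecComponent (w : Fin n → ℕ) {ι : Type} [Fintype ι] (deg : ι → ℤ)
    (v : ι → MvPolynomial (Fin n) k) : ∃ T : Finset ℤ, v = ∑ e ∈ T, homogVecComponent w deg e v := by
  classical
  refine ⟨Finset.univ.biUnion fun j => (v j).support.image
    fun m => Finsupp.weight (fun i => (w i : ℤ)) m + deg j, ?_⟩
  ext j m
  simp only [Finset.sum_apply, homogVecComponent, coeff_sum, coeff_weightedHomogeneousComponent,
    eq_sub_iff_add_eq, Finset.sum_ite_eq]
  split_ifs with h
  · rfl
  · by_contra hc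
    refine h (Finset.mem_biUnion.2 ⟨j, Finset.mem_univ _, Finset.mem_image.2 ⟨m, ?_, rfl⟩⟩)
    exact mem_support_iff.2 hc

theorem le_span_isHomogVec {ι : Type} [Fintype ι] {deg : ι → ℤ}
    {K : Submodule (MvPolynomial (Fin n) k) (ι → MvPolynomial (Fin n) k)}
    (hK : ∀ v ∈ K, ∀ e, homogVecComponent w deg e v ∈ K) :
    K ≤ Submodule.span _ {v | v ∈ K ∧ ∃ e, IsHomogVec w deg v e} := by
  intro v hv
  obtain ⟨T, hT⟩ := exists_sum_homogVecComponent w deg v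
  rw [hT]
  exact Submodule.sum_mem _ fun e _ => Submodule.subset_span
    ⟨hK v hv e, e, isHomogVec_homogVecComponent deg e v⟩

theorem mulVec_homogVecComponent {ι κ : Type} [Fintype κ] {deg : ι → ℤ} {deg' : κ → ℤ}
    {M : Matrix ι κ (MvPolynomial (Fin n) k)} (hM : ∀ l j, IsHomog w (M l j) (deg' j - deg l))
    (e : ℤ) (v : κ → MvPolynomial (Fin n) k) :
    M.mulVec (homogVecComponent w deg' e v) = homogVecComponent w deg e (M.mulVec v) := by
  ext1 l
  simp only [Matrix.mulVec, dotProduct, homogVecComponent, map_sum]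
  refine Finset.sum_congr rfl fun j _ => ?_
  rw [← weightedHomogeneousComponent_add_mul (hM l j)]
  congr 2
  ring

/-- Take the least possible number of homogeneous generators. A homogeneous relation with a nonzero
constant term has a nonzero scalar as a coefficient, so it would express one generator through the
others. -/
theorem exists_minimal_homogVec_generators (hw : ∀ i, 0 < w i) {ι : Type} [Fintype ι]
    {deg : ι → ℤ} {K : Submodule (MvPolynomial (Fin n) k) (ι → MvPolynomial (Fin n) k)}
    (hK : ∀ v ∈ K, ∀ e, homogVecComponent w deg e v ∈ K) :
    ∃ (r : ℕ) (deg' : Fin r → ℤ) (M : Matrix ι (Fin r) (MvPolynomial (Fin n) k)),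
      (∀ l j, IsHomog w (M l j) (deg' j - deg l)) ∧ LinearMap.range M.mulVecLin = K ∧
      ∀ c e, M.mulVec c = 0 → IsHomogVec w deg' c e → ∀ j, constantCoeff (c j) = 0 := by
  classical
  have hex : ∃ (r : ℕ) (g : Fin r → ι → MvPolynomial (Fin n) k),
      (∀ j, ∃ e, IsHomogVec w deg (g j) e) ∧ Submodule.span _ (Set.range g) = K := by
    have hspan : Submodule.span _ {v | v ∈ K ∧ ∃ e, IsHomogVec w deg v e} = K :=
      le_antisymm (Submodule.span_le.2 fun v hv => hv.1) (le_span_isHomogVec hK)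
    have hfg : K.FG := IsNoetherian.noetherian K
    rw [← hspan, Submodule.fg_span_iff_fg_span_finset_subset] at hfg
    obtain ⟨T, hT, hT'⟩ := hfg
    refine ⟨T.card, fun j => T.equivFin.symm j, fun j => (hT (T.equivFin.symm j).2).2, ?_⟩
    rw [← hspan, hT']
    congr 1
    rw [Set.range_comp' (g := Subtype.val), T.equivFin.symm.range_eq_univ]
    simp
  obtain ⟨g, hg, hgK⟩ := Nat.find_spec hex
  have hmin := fun m => Nat.find_min hex (m := m)
  generalize Nat.find hex = r at g hg hgK hmin
  choose deg' hdeg' using hg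
  refine ⟨r, deg', Matrix.of fun l j => g j l, fun l j => hdeg' j l, ?_, ?_⟩
  · rw [Matrix.range_mulVecLin, ← hgK]
    rfl
  · intro c e hc hce j
    by_contra hj
    obtain ⟨u, hu⟩ : ∃ u, c j = C u := ⟨_, IsHomog.eq_C hw (hce j) hj⟩
    have hu0 : u ≠ 0 := by simpa [hu] using hj
    obtain ⟨r, rfl⟩ : ∃ s, r = s + 1 := ⟨r - 1, by have := j.pos; omega⟩
    refine hmin r (by omega) ⟨fun i => g (j.succAbove i), fun i => ⟨_, hdeg' _⟩, ?_⟩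
    rw [← hgK]
    refine le_antisymm (Submodule.span_mono ?_) (Submodule.span_le.2 ?_)
    · rintro _ ⟨i, rfl⟩
      exact ⟨_, rfl⟩
    rintro _ ⟨i, rfl⟩
    rcases Fin.eq_self_or_eq_succAbove j i with rfl | ⟨i, rfl⟩
    · have h1 : ∑ i, c i • g i = 0 := by
        rw [← hc]
        ext1 l
        simp [Matrix.mulVec, dotProduct, mul_comm]
      rw [Fin.sum_univ_succAbove _ i, hu] at h1
      have h2 : g i = -(C u⁻¹ : MvPolynomial (Fin n) k) •
          ∑ i_1, c (i.succAbove i_1) • g (i.succAbove i_1) := by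
        rw [← neg_eq_iff_add_eq_zero.2 h1, smul_neg, neg_smul, neg_neg, smul_smul, ← C_mul,
          inv_mul_cancel₀ hu0, C_1, one_smul]
      rw [h2]
      exact Submodule.smul_mem _ _ (Submodule.sum_mem _ fun i _ =>
        Submodule.smul_mem _ _ (Submodule.subset_span ⟨i, rfl⟩))
    · exact Submodule.subset_span ⟨i, rfl⟩

/-- A homogeneous submodule of a graded free module whose homogeneous elements have all their
coordinates in the ideal generated by the variables. -/
structure HomogSubmodule (k : Type u) [Field k] {n : ℕ} (w : Fin n → ℕ) where
  ι : Type
  fin : Fintype ι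
  dec : DecidableEq ι
  deg : ι → ℤ
  K : Submodule (MvPolynomial (Fin n) k) (ι → MvPolynomial (Fin n) k)
  component_mem : ∀ v ∈ K, ∀ e, homogVecComponent w deg e v ∈ K
  constantCoeff_eq_zero : ∀ v ∈ K, ∀ e, IsHomogVec w deg v e → ∀ l, constantCoeff (v l) = 0

attribute [instance] HomogSubmodule.fin HomogSubmodule.dec

/-- The syzygies of a minimal presentation satisfy the same two conditions as the module presented,
so the construction can be iterated. -/
theorem HomogSubmodule.exists_presentation (hw : ∀ i, 0 < w i) (s : HomogSubmodule k w) :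
    ∃ (s' : HomogSubmodule k w) (M : Matrix s.ι s'.ι (MvPolynomial (Fin n) k)),
      (∀ l j, IsHomog w (M l j) (s'.deg j - s.deg l)) ∧ LinearMap.range M.mulVecLin = s.K ∧
      LinearMap.ker M.mulVecLin = s'.K := by
  obtain ⟨r, deg', M, h1, h2, h3⟩ := exists_minimal_homogVec_generators hw s.component_mem
  refine ⟨⟨Fin r, inferInstance, inferInstance, deg', LinearMap.ker M.mulVecLin, ?_, ?_⟩,
    M, h1, h2, rfl⟩
  · intro v hv e
    rw [LinearMap.mem_ker, Matrix.mulVecLin_apply] at hv ⊢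
    rw [mulVec_homogVecComponent h1, hv]
    ext1 l
    simp [homogVecComponent]
  · exact fun v hv e hve l => h3 v e hv hve l

/-- The kernel of the presentation of the semigroup ring as a quotient of the polynomial ring. -/
noncomputable def toricKer (k : Type u) [Field k] {n : ℕ} {w : Fin n → ℕ} (hw : ∀ i, 0 < w i) :
    HomogSubmodule k w where
  ι := Unit
  fin := inferInstance
  dec := inferInstance
  deg _ := 0
  K := LinearMap.ker ((Algebra.linearMap _ (SemigroupRing k w)).comp (LinearMap.proj ()))
  component_mem v hv e := by
    have hv' : toricHom k w (v ()) = 0 := congrArg Subtype.val hv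
    refine Subtype.ext ?_
    change toricHom k w (weightedHomogeneousComponent (fun i => (w i : ℤ)) (e - 0) (v ())) = 0
    ext f
    rw [coeff_toricHom_weightedHomogeneousComponent, hv']
    simp
  constantCoeff_eq_zero v hv e hve l := by
    have hv' : toricHom k w (v ()) = 0 := congrArg Subtype.val hv
    by_contra hl
    have := IsHomog.eq_C hw (hve l) hl
    rw [this] at hv'
    simp [toricHom] at hv'
    exact hl hv'

theorem exists_isMinimalResolution (k : Type u) [Field k] {n : ℕ} {w : Fin n → ℕ}
    (hw : ∀ i, 0 < w i) : ∃ F : GradedFreeComplex k w, F.IsMinimalResolution := by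
  choose next M hM hrange hker using fun s : HomogSubmodule k w => s.exists_presentation hw
  let s : ℕ → HomogSubmodule k w := fun i => Nat.rec (toricKer k hw) (fun _ t => next t) i
  have hexact : ∀ i, Function.Exact (M (s (i + 1))).mulVecLin (M (s i)).mulVecLin := fun i =>
    LinearMap.exact_iff.2 ((hker (s i)).trans (hrange (s (i + 1))).symm)
  let ε : (Unit → MvPolynomial (Fin n) k) →ₗ[MvPolynomial (Fin n) k] SemigroupRing k w :=
    (Algebra.linearMap _ (SemigroupRing k w)).comp (LinearMap.proj ())
  refine ⟨{
    ι := fun i => (s i).ι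
    fin := fun i => (s i).fin
    dec := fun i => (s i).dec
    deg := fun i => (s i).deg
    d := fun i => M (s i)
    d_homog := fun i => hM (s i)
    d_comp_d := fun i => ?_ }, ?_, ?_, ?_⟩
  · apply Matrix.toLin'.injective
    rw [Matrix.toLin'_mul, map_zero]
    exact (hexact i).linearMap_comp_eq_zero
  · exact hexact
  · refine ⟨ε, ?_, ?_, ?_⟩
    · rintro ⟨_, p, rfl⟩
      exact ⟨fun _ => p, rfl⟩
    · exact LinearMap.exact_iff.2 (hrange (toricKer k hw)).symm
    · intro l e he
      have h1 : SemigroupRing.incl k w (ε (Pi.single () 1)) = 1 := by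
        simp [ε]
      refine (congrArg (fun p => Polynomial.coeff p e) h1).trans ?_
      rw [Polynomial.coeff_one, if_neg]
      rintro rfl
      exact he rfl
  · intro i l j
    rw [mem_span_range_X_iff]
    -- Each column of `M (s i)` is a homogeneous element of `(s i).K`.
    refine (s i).constantCoeff_eq_zero (fun l => M (s i) l j) ?_ _ (fun l => hM (s i) l j) l
    rw [← hrange]
    exact ⟨Pi.single j 1, by simp; rfl⟩

/-! ### Exactness of the cone of a multiplication -/

section Cone

variable {R ι₀ ι₁ ι₂ ι₃ : Type*} [CommRing R] [Fintype ι₁] [DecidableEq ι₁] [Fintype ι₂]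

/-- Write `v = (v₁, v₀)` with `v₀ = d f`. Then `v₁ + ρ f` is a cycle, hence equal to `d' g`, and
`(g, -f)` maps to `v`. -/
theorem mem_range_fromBlocks {d : Matrix ι₀ ι₁ R} {d' : Matrix ι₁ ι₂ R}
    (h : Function.Exact d'.mulVecLin d.mulVecLin) (ρ : R) {v : ι₁ ⊕ ι₀ → R}
    (hv : d.mulVec (v ∘ Sum.inl) + ρ • (v ∘ Sum.inr) = 0)
    (hv' : v ∘ Sum.inr ∈ LinearMap.range d.mulVecLin) :
    v ∈ LinearMap.range (Matrix.fromBlocks d' (ρ • (1 : Matrix ι₁ ι₁ R)) 0 (-d)).mulVecLin := by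
  obtain ⟨f, hf⟩ := hv'
  rw [Matrix.mulVecLin_apply] at hf
  obtain ⟨g, hg⟩ := (h (v ∘ Sum.inl + ρ • f)).1 (by
    rw [Matrix.mulVecLin_apply, Matrix.mulVec_add, Matrix.mulVec_smul, hf, hv])
  refine ⟨Sum.elim g (-f), ?_⟩
  rw [Matrix.mulVecLin_apply] at hg ⊢
  rw [Matrix.fromBlocks_mulVec, Sum.elim_comp_inl, Sum.elim_comp_inr, hg]
  rw [← Sum.elim_comp_inl_inr v]
  congr 1
  · rw [Matrix.smul_mulVec, Matrix.one_mulVec, smul_neg]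
    simp
  · rw [Matrix.zero_mulVec, Matrix.neg_mulVec, Matrix.mulVec_neg, hf]
    simp

/-- At the bottom the second component of a cycle need not be a cycle of `d`; it is a boundary
because `ρ` is a nonzerodivisor on the cokernel of `d`. -/
theorem exact_fromBlocks_fromCols [Fintype ι₀] [DecidableEq ι₀]
    {d : Matrix ι₀ ι₁ R} {d' : Matrix ι₁ ι₂ R}
    (h : Function.Exact d'.mulVecLin d.mulVecLin) {ρ : R}
    (hρ : ∀ f, ρ • f ∈ LinearMap.range d.mulVecLin → f ∈ LinearMap.range d.mulVecLin) :
    Function.Exact (Matrix.fromBlocks d' (ρ • (1 : Matrix ι₁ ι₁ R)) 0 (-d)).mulVecLin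
      (Matrix.fromCols d (ρ • (1 : Matrix ι₀ ι₀ R))).mulVecLin := by
  intro v
  rw [Matrix.mulVecLin_apply, Matrix.fromCols_mulVec, Matrix.smul_mulVec, Matrix.one_mulVec]
  constructor
  · intro hv
    refine mem_range_fromBlocks h ρ hv (hρ _ ⟨-(v ∘ Sum.inl), ?_⟩)
    rw [Matrix.mulVecLin_apply, Matrix.mulVec_neg, neg_eq_iff_add_eq_zero, hv]
  · rintro ⟨u, rfl⟩
    have h0 : d.mulVec (d'.mulVec (u ∘ Sum.inl)) = 0 := h.apply_apply_eq_zero _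
    rw [Matrix.mulVecLin_apply, Matrix.fromBlocks_mulVec, Sum.elim_comp_inl, Sum.elim_comp_inr,
      Matrix.mulVec_add, h0, Matrix.smul_mulVec, Matrix.one_mulVec, Matrix.mulVec_smul,
      Matrix.zero_mulVec, Matrix.neg_mulVec]
    simp

/-- Higher up, the second component of a cycle is itself a cycle, hence a boundary, whatever `ρ` is.
-/
theorem exact_fromBlocks_fromBlocks [Fintype ι₃] [DecidableEq ι₂]
    {d : Matrix ι₀ ι₁ R} {d' : Matrix ι₁ ι₂ R} {d'' : Matrix ι₂ ι₃ R}
    (h : Function.Exact d'.mulVecLin d.mulVecLin) (h' : Function.Exact d''.mulVecLin d'.mulVecLin)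
    (ρ : R) :
    Function.Exact (Matrix.fromBlocks d'' (ρ • (1 : Matrix ι₂ ι₂ R)) 0 (-d')).mulVecLin
      (Matrix.fromBlocks d' (ρ • (1 : Matrix ι₁ ι₁ R)) 0 (-d)).mulVecLin := by
  intro v
  rw [Matrix.mulVecLin_apply, Matrix.fromBlocks_mulVec, Matrix.smul_mulVec, Matrix.one_mulVec]
  constructor
  · intro hv
    refine mem_range_fromBlocks h' ρ (funext fun l => congrFun hv (Sum.inl l))
      ((h _).1 (funext fun l => ?_))
    have := congrFun hv (Sum.inr l)
    simpa [Matrix.neg_mulVec] using this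
  · rintro ⟨u, rfl⟩
    have h0 : d'.mulVec (d''.mulVec (u ∘ Sum.inl)) = 0 := h'.apply_apply_eq_zero _
    have h1 : d.mulVec (d'.mulVec (u ∘ Sum.inr)) = 0 := h.apply_apply_eq_zero _
    rw [Matrix.mulVecLin_apply, Matrix.fromBlocks_mulVec, Sum.elim_comp_inl, Sum.elim_comp_inr,
      Matrix.mulVec_add, h0, Matrix.smul_mulVec, Matrix.one_mulVec, Matrix.mulVec_smul,
      Matrix.zero_mulVec, Matrix.zero_mulVec, Matrix.neg_mulVec, Matrix.neg_mulVec]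
    simp only [zero_add, Matrix.mulVec_neg, h1]
    ext (l | l) <;> simp

end Cone

/-! ### Extension of scalars to `R_A[x₀]` -/

section Extend

variable {k : Type u} [Field k] {n : ℕ}

theorem finSuccEquiv_rename_succ (p : MvPolynomial (Fin n) k) :
    finSuccEquiv k n (rename Fin.succ p) = Polynomial.C p := by
  induction p using MvPolynomial.induction_on with
  | C a => simp [finSuccEquiv_apply]
  | add p q hp hq => simp [hp, hq]
  | mul_X p i hp => simp only [map_mul, hp, rename_X, finSuccEquiv_X_succ]

/-- The vector of the coefficients of `x₀ ^ j` in the entries of a vector. -/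
noncomputable def coeffVec {κ : Type} (j : ℕ) (v : κ → MvPolynomial (Fin (n + 1)) k) :
    κ → MvPolynomial (Fin n) k :=
  fun l => (finSuccEquiv k n (v l)).coeff j

theorem mulVec_coeffVec {ι κ : Type} [Fintype κ] (D : Matrix ι κ (MvPolynomial (Fin n) k)) (j : ℕ)
    (v : κ → MvPolynomial (Fin (n + 1)) k) :
    D.mulVec (coeffVec j v) = coeffVec j ((D.map (rename Fin.succ)).mulVec v) := by
  ext1 l
  simp [Matrix.mulVec, dotProduct, coeffVec, finSuccEquiv_rename_succ]

theorem exists_sum_coeffVec {κ : Type} [Fintype κ] (v : κ → MvPolynomial (Fin (n + 1)) k) :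
    ∃ N, v = ∑ j ∈ Finset.range N,
      (X 0 ^ j : MvPolynomial (Fin (n + 1)) k) • fun l => rename Fin.succ (coeffVec j v l) := by
  refine ⟨(Finset.univ.sup fun l => (finSuccEquiv k n (v l)).natDegree) + 1, ?_⟩
  ext1 l
  apply (finSuccEquiv k n).injective
  rw [Finset.sum_apply, map_sum, (finSuccEquiv k n (v l)).as_sum_range' _ (Nat.lt_succ_of_le
    (Finset.le_sup (f := fun l => (finSuccEquiv k n (v l)).natDegree) (Finset.mem_univ l)))]
  refine Finset.sum_congr rfl fun j _ => ?_
  simp only [Pi.smul_apply, smul_eq_mul, map_mul, map_pow, finSuccEquiv_X_zero,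
    finSuccEquiv_rename_succ, coeffVec, ← Polynomial.C_mul_X_pow_eq_monomial, mul_comm]

theorem mem_range_map_rename {ι κ : Type} [Fintype ι] [Fintype κ]
    (D : Matrix ι κ (MvPolynomial (Fin n) k)) {v : ι → MvPolynomial (Fin (n + 1)) k}
    (hv : ∀ j, coeffVec j v ∈ LinearMap.range D.mulVecLin) :
    v ∈ LinearMap.range (D.map (rename Fin.succ)).mulVecLin := by
  choose u hu using hv
  obtain ⟨N, hN⟩ := exists_sum_coeffVec v
  rw [hN]
  refine Submodule.sum_mem _ fun j _ => Submodule.smul_mem _ _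
    ⟨fun l => rename Fin.succ (u j l), ?_⟩
  rw [← hu j]
  ext1 l
  simp [Matrix.mulVec, dotProduct]

theorem coeffVec_zero {κ : Type} (j : ℕ) :
    coeffVec j (0 : κ → MvPolynomial (Fin (n + 1)) k) = 0 := by
  ext1 l
  simp [coeffVec]

/-- The matrices do not involve `x₀`, so they act separately on the coefficient of each power of
`x₀`; this is flatness made explicit. -/
theorem exact_map_rename {ι κ μ : Type} [Fintype ι] [Fintype κ] [Fintype μ]
    {D : Matrix ι κ (MvPolynomial (Fin n) k)} {D' : Matrix κ μ (MvPolynomial (Fin n) k)}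
    (h : Function.Exact D'.mulVecLin D.mulVecLin) (h0 : D * D' = 0) :
    Function.Exact (D'.map (rename (Fin.succ : Fin n → Fin (n + 1)))).mulVecLin
      (D.map (rename Fin.succ)).mulVecLin := by
  intro v
  constructor
  · intro hv
    refine mem_range_map_rename D' fun j => (h _).1 ?_
    rw [Matrix.mulVecLin_apply] at hv ⊢
    rw [mulVec_coeffVec, hv, coeffVec_zero]
  · rintro ⟨u, rfl⟩
    rw [← LinearMap.comp_apply, ← Matrix.mulVecLin_mul, ← Matrix.map_mul, h0]
    ext1 l
    simp [Matrix.mulVec, dotProduct]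

end Extend

/-! ### The ring `k[C]` as the quotient of `k[A][x₀]` by `ρ` -/

section Augmentation

variable {k : Type u} [Field k] {n : ℕ} {a : Fin n → ℕ} {k₁ k₂ : ℕ}

/-- The coefficientwise reduction `k[x₀, …, xₙ] = k[x₁, …, xₙ][x₀] → k[A][x₀]`. -/
noncomputable def reduceHom (k : Type u) [Field k] {n : ℕ} (a : Fin n → ℕ) :
    MvPolynomial (Fin (n + 1)) k →+* Polynomial (SemigroupRing k a) :=
  (Polynomial.mapRingHom (algebraMap (MvPolynomial (Fin n) k) (SemigroupRing k a))).comp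
    (finSuccEquiv k n).toRingEquiv.toRingHom

theorem reduceHom_apply (p : MvPolynomial (Fin (n + 1)) k) :
    reduceHom k a p = (finSuccEquiv k n p).map (algebraMap _ (SemigroupRing k a)) := rfl

theorem algebraMap_semigroupRing_surjective :
    Function.Surjective (algebraMap (MvPolynomial (Fin n) k) (SemigroupRing k a)) := by
  rintro ⟨_, p, rfl⟩
  exact ⟨p, rfl⟩

theorem incl_algebraMap (p : MvPolynomial (Fin n) k) :
    SemigroupRing.incl k a (algebraMap _ _ p) = toricHom k a p := rfl

theorem incl_injective : Function.Injective (SemigroupRing.incl k a) := Subtype.val_injective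

theorem reduceHom_surjective : Function.Surjective (reduceHom k a) :=
  (Polynomial.map_surjective _ algebraMap_semigroupRing_surjective).comp
    (finSuccEquiv k n).surjective

/-- The homomorphism `k[A][x₀] → k[t]`, `f(t) ↦ f(t ^ k₂)`, `x₀ ↦ t ^ k₁`. -/
noncomputable def splitHom (k : Type u) [Field k] {n : ℕ} (a : Fin n → ℕ) (k₁ k₂ : ℕ) :
    Polynomial (SemigroupRing k a) →+* Polynomial k :=
  Polynomial.eval₂RingHom
    ((Polynomial.expand k k₂).toRingHom.comp (SemigroupRing.incl k a).toRingHom)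
    (Polynomial.X ^ k₁)

theorem splitHom_C (s : SemigroupRing k a) :
    splitHom k a k₁ k₂ (Polynomial.C s) =
      Polynomial.expand k k₂ (SemigroupRing.incl k a s) := by
  simp [splitHom]

theorem splitHom_X : splitHom k a k₁ k₂ Polynomial.X = Polynomial.X ^ k₁ := by
  simp [splitHom]

theorem splitHom_reduceHom (p : MvPolynomial (Fin (n + 1)) k) :
    splitHom k a k₁ k₂ (reduceHom k a p) = toricHom k (splitGens a k₁ k₂) p := by
  have h : (splitHom k a k₁ k₂).comp (reduceHom k a) =
      (toricHom k (splitGens a k₁ k₂)).toRingHom := by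
    refine MvPolynomial.ringHom_ext (fun c => ?_) fun i => ?_
    · change splitHom k a k₁ k₂ (reduceHom k a (C c)) = toricHom k _ (C c)
      rw [reduceHom_apply, finSuccEquiv_apply, coe_eval₂Hom, eval₂_C, RingHom.comp_apply,
        Polynomial.map_C, splitHom_C, incl_algebraMap]
      simp [toricHom]
    · change splitHom k a k₁ k₂ (reduceHom k a (X i)) = toricHom k _ (X i)
      rw [reduceHom_apply]
      refine Fin.cases ?_ (fun i => ?_) i
      · rw [finSuccEquiv_X_zero, Polynomial.map_X, splitHom_X]
        simp [toricHom, splitGens]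
      · rw [finSuccEquiv_X_succ, Polynomial.map_C, splitHom_C, incl_algebraMap]
        simp [toricHom, splitGens, pow_mul]
  exact congrArg (fun f => f p) h

/-- The `j`-th term of `r` contributes only exponents congruent to `k₁j` modulo `k₂`, and these
classes are distinct for `j < k₂`. -/
theorem eq_zero_of_splitHom_eq_zero (hk₂ : 0 < k₂) (hco : Nat.Coprime k₁ k₂)
    {r : Polynomial (SemigroupRing k a)} (hr : r.natDegree < k₂)
    (h : splitHom k a k₁ k₂ r = 0) : r = 0 := by
  have hsum : splitHom k a k₁ k₂ r = ∑ j ∈ Finset.range k₂,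
      Polynomial.expand k k₂ (SemigroupRing.incl k a (r.coeff j)) * Polynomial.X ^ (k₁ * j) := by
    conv_lhs => rw [r.as_sum_range_C_mul_X_pow' hr]
    simp only [map_sum, map_mul, map_pow, splitHom_C, splitHom_X, pow_mul]
  ext1 j
  rcases le_or_gt k₂ j with hj | hj
  · rw [Polynomial.coeff_eq_zero_of_natDegree_lt (hr.trans_le hj), Polynomial.coeff_zero]
  apply incl_injective
  rw [Polynomial.coeff_zero, map_zero]
  ext f
  -- Only the `j`-th summand reaches this exponent, and there it shows the coefficient of `t ^ f` in
  -- `r.coeff j`.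
  have hc := congrArg (fun p => p.coeff (f * k₂ + k₁ * j)) (hsum.symm.trans h)
  simp only [Polynomial.finsetSum_coeff, Polynomial.coeff_zero] at hc
  rw [Finset.sum_eq_single j] at hc
  · rwa [Polynomial.coeff_mul_X_pow, Polynomial.coeff_expand_mul hk₂] at hc
  · intro i hi hij
    rw [Polynomial.coeff_mul_X_pow']
    split_ifs with hle
    · rw [Polynomial.coeff_expand hk₂, if_neg]
      rintro ⟨c, hc⟩
      refine hij ?_
      have h1 : f * k₂ + k₁ * j = k₂ * c + k₁ * i := by omega
      have h2 : k₁ * j ≡ k₁ * i [MOD k₂] := by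
        have := congrArg (· % k₂) h1
        simpa [Nat.ModEq, Nat.add_mod] using this
      have h3 : j ≡ i [MOD k₂] := Nat.ModEq.cancel_left_of_coprime (by simpa using hco.symm) h2
      exact (h3.eq_of_lt_of_lt hj (Finset.mem_range.1 hi)).symm
    · rfl
  · intro hj'
    exact absurd (Finset.mem_range.2 hj) hj'

variable (α : Fin n → ℕ)

theorem reduceHom_rho :
    reduceHom k a (rho k k₂ α) = Polynomial.X ^ k₂ -
      Polynomial.C (algebraMap (MvPolynomial (Fin n) k) (SemigroupRing k a) (∏ i, X i ^ α i)) := by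
  have h : (∏ i : Fin n, (X i.succ : MvPolynomial (Fin (n + 1)) k) ^ α i) =
      rename Fin.succ (∏ i, X i ^ α i) := by simp
  rw [reduceHom_apply, rho, h, map_sub, map_pow, finSuccEquiv_X_zero, finSuccEquiv_rename_succ,
    Polynomial.map_sub, Polynomial.map_pow, Polynomial.map_X, Polynomial.map_C]

theorem incl_algebraMap_prod (hα : k₁ = ∑ i, α i * a i) :
    SemigroupRing.incl k a
      (algebraMap (MvPolynomial (Fin n) k) _ (∏ i, X i ^ α i)) = Polynomial.X ^ k₁ := by
  rw [incl_algebraMap, hα]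
  simp [toricHom, ← pow_mul, Finset.prod_pow_eq_pow_sum, mul_comm]

theorem splitHom_reduceHom_rho (hα : k₁ = ∑ i, α i * a i) :
    splitHom k a k₁ k₂ (reduceHom k a (rho k k₂ α)) = 0 := by
  rw [reduceHom_rho, map_sub, map_pow, splitHom_X, splitHom_C, incl_algebraMap_prod α hα]
  simp [← pow_mul, mul_comm]

/-- Divide by the monic image of `ρ`: the remainder has degree below `k₂` and still maps to zero, so
it vanishes. -/
theorem exists_eq_mul_of_splitHom_eq_zero (hk₂ : 0 < k₂) (hco : Nat.Coprime k₁ k₂)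
    (hα : k₁ = ∑ i, α i * a i) {q : Polynomial (SemigroupRing k a)}
    (h : splitHom k a k₁ k₂ q = 0) : ∃ q', q = reduceHom k a (rho k k₂ α) * q' := by
  nontriviality SemigroupRing k a
  have hmonic : (reduceHom k a (rho k k₂ α)).Monic := by
    rw [reduceHom_rho]
    exact Polynomial.monic_X_pow_sub_C _ hk₂.ne'
  have hdeg : (reduceHom k a (rho k k₂ α)).natDegree = k₂ := by
    rw [reduceHom_rho, Polynomial.natDegree_X_pow_sub_C]
  have h0 := splitHom_reduceHom_rho (k := k) (k₂ := k₂) α hα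
  refine ⟨q /ₘ reduceHom k a (rho k k₂ α), ?_⟩
  have hq := Polynomial.modByMonic_add_div q (reduceHom k a (rho k k₂ α))
  rw [eq_zero_of_splitHom_eq_zero (r := q %ₘ reduceHom k a (rho k k₂ α)) hk₂ hco, zero_add] at hq
  · exact hq.symm
  · conv_rhs => rw [← hdeg]
    refine Polynomial.natDegree_modByMonic_lt _ hmonic fun h1 => ?_
    rw [h1, Polynomial.natDegree_one] at hdeg
    omega
  · have h2 := congrArg (splitHom k a k₁ k₂) hq
    rwa [map_add, map_mul, h0, zero_mul, add_zero, h] at h2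

/-- The extension of `ε : F₀ → k[A]` to `F₀[x₀] → k[A][x₀]`. -/
noncomputable def extendAug {ι : Type} [Fintype ι] [DecidableEq ι]
    (ε : (ι → MvPolynomial (Fin n) k) →ₗ[MvPolynomial (Fin n) k] SemigroupRing k a)
    (v : ι → MvPolynomial (Fin (n + 1)) k) : Polynomial (SemigroupRing k a) :=
  ∑ l, reduceHom k a (v l) * Polynomial.C (ε (Pi.single l 1))

section ExtendAug

variable {ι : Type} [Fintype ι] [DecidableEq ι]
    (ε : (ι → MvPolynomial (Fin n) k) →ₗ[MvPolynomial (Fin n) k] SemigroupRing k a)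

theorem aug_eq_sum (v : ι → MvPolynomial (Fin n) k) :
    ε v = ∑ l, algebraMap _ (SemigroupRing k a) (v l) * ε (Pi.single l 1) := by
  conv_lhs => rw [pi_eq_sum_univ' v, map_sum]
  refine Finset.sum_congr rfl fun l _ => ?_
  rw [map_smul, Algebra.smul_def]

theorem coeff_extendAug (v : ι → MvPolynomial (Fin (n + 1)) k) (j : ℕ) :
    (extendAug ε v).coeff j = ε (coeffVec j v) := by
  rw [aug_eq_sum, extendAug]
  simp [reduceHom_apply, coeffVec]

theorem extendAug_add (v v' : ι → MvPolynomial (Fin (n + 1)) k) :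
    extendAug ε (v + v') = extendAug ε v + extendAug ε v' := by
  simp [extendAug, add_mul, Finset.sum_add_distrib]

theorem extendAug_smul (p : MvPolynomial (Fin (n + 1)) k) (v : ι → MvPolynomial (Fin (n + 1)) k) :
    extendAug ε (p • v) = reduceHom k a p * extendAug ε v := by
  simp [extendAug, Finset.mul_sum, mul_assoc]

/-- Together with `reduceHom_surjective` this makes `extendAug ε` surjective. -/
theorem exists_extendAug_eq_reduceHom (hε : Function.Surjective ε)
    (p : MvPolynomial (Fin (n + 1)) k) : ∃ v, extendAug ε v = reduceHom k a p := by
  obtain ⟨u, hu⟩ := hε 1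
  refine ⟨p • fun l => rename Fin.succ (u l), ?_⟩
  rw [extendAug_smul]
  convert mul_one _
  rw [← map_one Polynomial.C, ← hu, aug_eq_sum, extendAug, map_sum]
  simp [reduceHom_apply, finSuccEquiv_rename_succ]

theorem extendAug_single (l : ι) :
    extendAug ε (Pi.single l 1) = Polynomial.C (ε (Pi.single l 1)) := by
  rw [extendAug, Finset.sum_eq_single l]
  · simp
  · intro i _ hi
    simp [hi]
  · simp

theorem extendAug_eq_zero_iff {κ : Type} [Fintype κ] {D : Matrix ι κ (MvPolynomial (Fin n) k)}
    (hε : Function.Exact D.mulVecLin ε) (v : ι → MvPolynomial (Fin (n + 1)) k) :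
    extendAug ε v = 0 ↔ v ∈ LinearMap.range (D.map (rename Fin.succ)).mulVecLin := by
  constructor
  · intro hv
    refine mem_range_map_rename D fun j => (hε _).1 ?_
    rw [← coeff_extendAug, hv, Polynomial.coeff_zero]
  · rintro ⟨u, rfl⟩
    ext1 j
    rw [coeff_extendAug, Matrix.mulVecLin_apply, ← mulVec_coeffVec, Polynomial.coeff_zero]
    exact (hε _).2 ⟨_, rfl⟩

end ExtendAug

theorem exists_incl_eq_expand (s : SemigroupRing k a) (k₁ k₂ : ℕ) :
    ∃ s' : SemigroupRing k (splitGens a k₁ k₂),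
      SemigroupRing.incl k _ s' = Polynomial.expand k k₂ (SemigroupRing.incl k a s) := by
  obtain ⟨p, rfl⟩ := algebraMap_semigroupRing_surjective s
  refine ⟨algebraMap _ _ (rename Fin.succ p), ?_⟩
  rw [incl_algebraMap, ← splitHom_reduceHom, reduceHom_apply, finSuccEquiv_rename_succ,
    Polynomial.map_C, splitHom_C]

theorem constantCoeff_rho (hk₂ : 0 < k₂) (hk₁ : 0 < k₁) (hα : k₁ = ∑ i, α i * a i) :
    constantCoeff (rho k k₂ α) = 0 := by
  obtain ⟨i, hi⟩ : ∃ i, α i ≠ 0 := by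
    by_contra! h
    simp [h] at hα
    omega
  rw [rho, map_sub, map_pow, constantCoeff_X, zero_pow hk₂.ne', map_prod, zero_sub, neg_eq_zero]
  exact Finset.prod_eq_zero (Finset.mem_univ i) (by simp [hi])

end Augmentation

theorem exists_splitCone_augmentation {k : Type u} [Field k] {n : ℕ} {a : Fin n → ℕ} {k₁ k₂ : ℕ}
    (hk₂ : 0 < k₂) (hco : Nat.Coprime k₁ k₂) (α : Fin n → ℕ) (hα : k₁ = ∑ i, α i * a i)
    {ι κ : Type} [Fintype ι] [DecidableEq ι] [Fintype κ] {deg : ι → ℤ}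
    {D : Matrix ι κ (MvPolynomial (Fin n) k)}
    {ε : (ι → MvPolynomial (Fin n) k) →ₗ[MvPolynomial (Fin n) k] SemigroupRing k a}
    (hs : Function.Surjective ε) (he : Function.Exact D.mulVecLin ε)
    (hdeg : ∀ (l : ι) (e : ℕ), (e : ℤ) ≠ deg l →
      (SemigroupRing.incl k a (ε (Pi.single l 1))).coeff e = 0) :
    ∃ ε' : (ι → MvPolynomial (Fin (n + 1)) k) →ₗ[MvPolynomial (Fin (n + 1)) k]
        SemigroupRing k (splitGens a k₁ k₂),
      Function.Surjective ε' ∧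
      Function.Exact (Matrix.fromCols (D.map (rename Fin.succ))
        (rho k k₂ α • (1 : Matrix ι ι (MvPolynomial (Fin (n + 1)) k)))).mulVecLin ε' ∧
      ∀ (l : ι) (e : ℕ), (e : ℤ) ≠ k₂ * deg l →
        (SemigroupRing.incl k _ (ε' (Pi.single l 1))).coeff e = 0 := by
  -- Only the values of `ψ` on the images of the basis are used, so its additivity is not needed.
  choose ψ hψ using fun s : SemigroupRing k a => exists_incl_eq_expand s k₁ k₂
  let ε' : (ι → MvPolynomial (Fin (n + 1)) k) →ₗ[MvPolynomial (Fin (n + 1)) k]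
      SemigroupRing k (splitGens a k₁ k₂) :=
    Fintype.linearCombination _ fun l => ψ (ε (Pi.single l 1))
  have hε' : ∀ v, SemigroupRing.incl k _ (ε' v) = splitHom k a k₁ k₂ (extendAug ε v) := by
    intro v
    simp only [ε', Fintype.linearCombination_apply, Algebra.smul_def, map_sum, map_mul,
      incl_algebraMap, hψ, extendAug, splitHom_C, splitHom_reduceHom]
  refine ⟨ε', ?_, ?_, ?_⟩
  · intro s
    obtain ⟨p, rfl⟩ := algebraMap_semigroupRing_surjective s
    obtain ⟨v, hv⟩ := exists_extendAug_eq_reduceHom ε hs p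
    refine ⟨v, incl_injective ?_⟩
    rw [hε', hv, splitHom_reduceHom, incl_algebraMap]
  · intro v
    rw [← map_eq_zero_iff _ (incl_injective (k := k)), hε']
    constructor
    · intro hv
      obtain ⟨q, hq⟩ := exists_eq_mul_of_splitHom_eq_zero α hk₂ hco hα hv
      obtain ⟨p, rfl⟩ := reduceHom_surjective q
      obtain ⟨f, hf⟩ := exists_extendAug_eq_reduceHom ε hs p
      -- The image of `v` is `ρ` times that of `f`, so `v - ρ f` comes from `F₁ ⊗ R`.
      obtain ⟨g, hg⟩ := (extendAug_eq_zero_iff ε he (v + (-rho k k₂ α) • f)).1 (by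
        rw [extendAug_add, extendAug_smul, hf, hq, map_neg]
        ring)
      refine ⟨Sum.elim g f, ?_⟩
      rw [Matrix.mulVecLin_apply] at hg ⊢
      rw [Matrix.fromCols_mulVec, Matrix.smul_mulVec, Matrix.one_mulVec, Sum.elim_comp_inl,
        Sum.elim_comp_inr, hg]
      simp
    · rintro ⟨u, rfl⟩
      rw [Matrix.mulVecLin_apply, Matrix.fromCols_mulVec, Matrix.smul_mulVec, Matrix.one_mulVec,
        extendAug_add, (extendAug_eq_zero_iff ε he (Matrix.mulVec _ _)).2 ⟨u ∘ Sum.inl, rfl⟩, zero_add,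
        extendAug_smul, map_mul, splitHom_reduceHom_rho α hα, zero_mul]
  · intro l e he'
    rw [hε', extendAug_single, splitHom_C, Polynomial.coeff_expand hk₂]
    split_ifs with hd
    · refine hdeg l _ fun h => he' ?_
      rw [← h]
      exact_mod_cast (Nat.mul_div_cancel' hd).symm
    · rfl

open GradedFreeComplex in
theorem isMinimalResolution_splitCone {k : Type u} [Field k] {n : ℕ} {a : Fin n → ℕ} {k₁ k₂ : ℕ}
    (hk₁ : 0 < k₁) (hk₂ : 0 < k₂) (hco : Nat.Coprime k₁ k₂) (α : Fin n → ℕ)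
    (hα : k₁ = ∑ i, α i * a i) {F : GradedFreeComplex k a} (hF : F.IsMinimalResolution) :
    (splitCone F k₁ k₂ α hα).IsMinimalResolution := by
  obtain ⟨ε, hs, he, hdeg⟩ := hF.augmentation
  have hexact := fun i => exact_map_rename (hF.exact i) (F.d_comp_d i)
  have hreg : ∀ q, reduceHom k a (rho k k₂ α) * q = 0 → q = 0 := by
    intro q hq
    have hmonic : (reduceHom k a (rho k k₂ α)).Monic := by
      rw [reduceHom_rho]
      exact Polynomial.monic_X_pow_sub_C _ hk₂.ne'
    exact hmonic.isRegular.left (by simpa using hq)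
  refine ⟨?_, ?_, ?_⟩
  · intro i
    cases i with
    | zero =>
      refine exact_fromBlocks_fromCols (hexact 0) fun f hf => ?_
      rw [← extendAug_eq_zero_iff ε he] at hf ⊢
      exact hreg _ (by rwa [← extendAug_smul])
    | succ i => exact exact_fromBlocks_fromBlocks (hexact i) (hexact (i + 1)) _
  · exact exists_splitCone_augmentation hk₂ hco α hα hs he hdeg
  · have hd : ∀ i l j, constantCoeff (rename (Fin.succ : Fin n → Fin (n + 1)) (F.d i l j)) = 0 :=
      fun i l j => by
        rw [constantCoeff_rename]
        exact mem_span_range_X_iff.1 (hF.minimal i l j)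
    have hρ := constantCoeff_rho (k := k) α hk₂ hk₁ hα
    have hone : ∀ i l j, constantCoeff
        ((rho k k₂ α • (1 : Matrix (F.ι i) (F.ι i) (MvPolynomial (Fin (n + 1)) k))) l j) = 0 :=
      fun i l j => by simp [hρ]
    intro i l j
    rw [mem_span_range_X_iff]
    match i, l, j with
    | 0, l, Sum.inl j => exact hd 0 l j
    | 0, l, Sum.inr j => exact hone 0 l j
    | i + 1, Sum.inl l, Sum.inl j => exact hd (i + 1) l j
    | i + 1, Sum.inl l, Sum.inr j => exact hone (i + 1) l j
    | i + 1, Sum.inr l, Sum.inl j => exact map_zero _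
    | i + 1, Sum.inr l, Sum.inr j =>
      exact (map_neg constantCoeff _).trans (neg_eq_zero.2 (hd i l j))

/-! ### Socle exponents of the two semigroups -/

section Semigroup

variable {n : ℕ}

theorem mem_closure_range_iff {w : Fin n → ℕ} {m : ℕ} :
    m ∈ AddSubmonoid.closure (Set.range w) ↔ ∃ α : Fin n → ℕ, m = ∑ i, α i * w i := by
  constructor
  · intro h
    induction h using AddSubmonoid.closure_induction with
    | mem x hx =>
      obtain ⟨i, rfl⟩ := hx
      exact ⟨Pi.single i 1, by simp [Pi.single_apply]⟩
    | zero => exact ⟨0, by simp⟩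
    | add x y _ _ hx hy =>
      obtain ⟨α, rfl⟩ := hx
      obtain ⟨β, rfl⟩ := hy
      exact ⟨α + β, by simp [add_mul, Finset.sum_add_distrib]⟩
  · rintro ⟨α, rfl⟩
    refine AddSubmonoid.sum_mem _ fun i _ => ?_
    rw [← smul_eq_mul]
    exact AddSubmonoid.nsmul_mem _ (AddSubmonoid.subset_closure (Set.mem_range_self i)) _

/-- The translate `e + S` of the semigroup `S` generated by `w`. -/
def semigroupTranslate (w : Fin n → ℕ) (e : ℕ) : Set ℕ :=
  {m | ∃ s ∈ AddSubmonoid.closure (Set.range w), m = e + s}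

theorem add_mem_semigroupTranslate {w : Fin n → ℕ} {e m s : ℕ} (hm : m ∈ semigroupTranslate w e)
    (hs : s ∈ AddSubmonoid.closure (Set.range w)) : m + s ∈ semigroupTranslate w e := by
  obtain ⟨t, ht, rfl⟩ := hm
  exact ⟨t + s, add_mem ht hs, add_assoc _ _ _⟩

/-- The exponents of the monomials that span the socle of `S / (t ^ e)`, for `S` the semigroup ring
of the semigroup generated by `w`. -/
def socleExponents (w : Fin n → ℕ) (e : ℕ) : Set ℕ :=
  {m | m ∈ AddSubmonoid.closure (Set.range w) ∧ m ∉ semigroupTranslate w e ∧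
    ∀ i, m + w i ∈ semigroupTranslate w e}

variable {a : Fin n → ℕ} {k₁ k₂ : ℕ}

theorem mem_closure_splitGens_iff {z : ℕ} :
    z ∈ AddSubmonoid.closure (Set.range (splitGens a k₁ k₂)) ↔
      ∃ s ∈ AddSubmonoid.closure (Set.range a), ∃ c, z = k₂ * s + k₁ * c := by
  simp only [mem_closure_range_iff]
  constructor
  · rintro ⟨α, rfl⟩
    refine ⟨∑ i : Fin n, α i.succ * a i, ⟨fun i => α i.succ, rfl⟩, α 0, ?_⟩
    rw [Fin.sum_univ_succ, Finset.mul_sum, add_comm]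
    congr 1
    · exact Finset.sum_congr rfl fun i _ => by simp [splitGens]; ring
    · simp [splitGens, mul_comm]
  · rintro ⟨_, ⟨α, rfl⟩, c, rfl⟩
    refine ⟨Fin.cons c α, ?_⟩
    rw [Fin.sum_univ_succ, Finset.mul_sum, add_comm]
    congr 1
    · simp [splitGens, mul_comm]
    · exact Finset.sum_congr rfl fun i _ => by simp [splitGens]; ring

/-- Modulo `k₂` the coefficient of `k₁` must be `j`. Its excess is a multiple of `k₂`, which moves
into the part divisible by `k₂` because `k₁` lies in the semigroup of `a`. -/
theorem mem_semigroupTranslate_splitGens_iff (hk₂ : 0 < k₂) (hco : Nat.Coprime k₁ k₂)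
    (hk₁ : k₁ ∈ AddSubmonoid.closure (Set.range a)) {e m j : ℕ} (hj : j < k₂) :
    k₂ * m + k₁ * j ∈ semigroupTranslate (splitGens a k₁ k₂) (k₂ * e) ↔
      m ∈ semigroupTranslate a e := by
  constructor
  · rintro ⟨_, hz, h⟩
    obtain ⟨s, hs, c, rfl⟩ := mem_closure_splitGens_iff.1 hz
    have h2 : k₁ * c ≡ k₁ * j [MOD k₂] := by
      have := congrArg (· % k₂) h
      simpa [Nat.ModEq, Nat.add_mod] using this.symm
    have h3 : c ≡ j [MOD k₂] := Nat.ModEq.cancel_left_of_coprime (by simpa using hco.symm) h2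
    have h4 : c = j + k₂ * (c / k₂) := by
      conv_lhs => rw [← Nat.mod_add_div c k₂, h3, Nat.mod_eq_of_lt hj]
    refine ⟨s + (c / k₂) * k₁, add_mem hs ?_, ?_⟩
    · rw [← smul_eq_mul]
      exact AddSubmonoid.nsmul_mem _ hk₁ _
    · refine Nat.eq_of_mul_eq_mul_left hk₂ ?_
      rw [h4] at h
      linarith
  · rintro ⟨s, hs, rfl⟩
    exact ⟨k₂ * s + k₁ * j, mem_closure_splitGens_iff.2 ⟨s, hs, j, rfl⟩, by ring⟩

/-- Write an element as `k₂m + k₁j` with `j < k₂`; whether it lies in the translate depends on `m`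
alone. Adding `k₁` merely raises `j` unless `j = k₂ - 1`, so a socle exponent has that `j`. -/
theorem bijOn_socleExponents (hk₂ : 0 < k₂) (hk₁pos : 0 < k₁) (hco : Nat.Coprime k₁ k₂)
    (hk₁ : k₁ ∈ AddSubmonoid.closure (Set.range a)) (e : ℕ) :
    Set.BijOn (fun m => k₂ * m + k₁ * (k₂ - 1)) (socleExponents a e)
      (socleExponents (splitGens a k₁ k₂) (k₂ * e)) := by
  have key := fun {m j} => mem_semigroupTranslate_splitGens_iff hk₂ hco hk₁ (e := e) (m := m)
    (j := j)
  refine ⟨?_, ?_, ?_⟩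
  · rintro m ⟨h1, h2, h3⟩
    refine ⟨mem_closure_splitGens_iff.2 ⟨m, h1, _, rfl⟩, ?_, fun i => ?_⟩
    · rwa [key (by omega)]
    · refine Fin.cases ?_ (fun i => ?_) i
      · have hmem : m + k₁ ∈ semigroupTranslate a e := by
          obtain ⟨α, hα⟩ := mem_closure_range_iff.1 hk₁
          obtain ⟨i, hi⟩ : ∃ i, α i ≠ 0 := by
            by_contra! h
            simp [h] at hα
            omega
          have h4 : k₁ = a i + ∑ j, (α - Pi.single i 1 : Fin n → ℕ) j * a j := by
            have h5 : α = Pi.single i 1 + (α - Pi.single i 1) := by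
              ext j
              by_cases hj : j = i
              · subst hj
                simp
                omega
              · simp [hj]
            rw [hα]
            conv_lhs => rw [h5]
            simp only [Pi.add_apply, add_mul, Finset.sum_add_distrib]
            congr 1
            simp [Pi.single_apply]
          rw [h4, ← add_assoc]
          exact add_mem_semigroupTranslate (h3 i) (mem_closure_range_iff.2 ⟨_, rfl⟩)
        have h6 : k₂ * m + k₁ * (k₂ - 1) + splitGens a k₁ k₂ 0 = k₂ * (m + k₁) + k₁ * 0 := by
          obtain ⟨c, rfl⟩ : ∃ c, k₂ = c + 1 := ⟨k₂ - 1, by omega⟩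
          simp [splitGens]
          ring
        exact h6 ▸ (key hk₂).2 hmem
      · have h6 : k₂ * m + k₁ * (k₂ - 1) + splitGens a k₁ k₂ i.succ =
            k₂ * (m + a i) + k₁ * (k₂ - 1) := by
          simp [splitGens]
          ring
        exact h6 ▸ (key (by omega)).2 (h3 i)
  · intro m _ m' _ h
    exact Nat.eq_of_mul_eq_mul_left hk₂ (Nat.add_right_cancel h)
  · rintro z ⟨h1, h2, h3⟩
    obtain ⟨m, j, hm, hj, rfl⟩ : ∃ m j, m ∈ AddSubmonoid.closure (Set.range a) ∧ j < k₂ ∧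
        z = k₂ * m + k₁ * j := by
      obtain ⟨s, hs, c, rfl⟩ := mem_closure_splitGens_iff.1 h1
      refine ⟨s + (c / k₂) • k₁, c % k₂, add_mem hs (AddSubmonoid.nsmul_mem _ hk₁ _),
        Nat.mod_lt _ hk₂, ?_⟩
      conv_lhs => rw [← Nat.mod_add_div c k₂]
      rw [smul_eq_mul]
      ring
    rw [key hj] at h2
    have hj' : j = k₂ - 1 := by
      by_contra hne
      have h4 := h3 0
      have h5 : k₂ * m + k₁ * j + splitGens a k₁ k₂ 0 = k₂ * m + k₁ * (j + 1) := by
        simp [splitGens]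
        ring
      rw [h5, key (by omega)] at h4
      exact h2 h4
    refine ⟨m, ⟨hm, h2, fun i => ?_⟩, by rw [hj']⟩
    rw [← key hj]
    convert h3 i.succ using 1
    simp [splitGens]
    ring

end Semigroup

/-! ### Monomial description of the semigroup ring -/

section Ring

variable {k : Type u} [Field k] {n : ℕ} {w : Fin n → ℕ}

theorem support_incl_subset (s : SemigroupRing k w) {m : ℕ}
    (hm : (SemigroupRing.incl k w s).coeff m ≠ 0) : m ∈ AddSubmonoid.closure (Set.range w) := by
  obtain ⟨p, rfl⟩ := algebraMap_semigroupRing_surjective s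
  rw [incl_algebraMap] at hm
  induction p using MvPolynomial.induction_on' with
  | monomial d c =>
    rw [toricHom_monomial, Polynomial.coeff_monomial] at hm
    have hd : Finsupp.weight w d = m := by
      by_contra h
      simp [h] at hm
    rw [mem_closure_range_iff]
    refine ⟨d, ?_⟩
    rw [← hd, Finsupp.weight_apply, Finsupp.sum_fintype _ _ (by simp)]
    rfl
  | add p q hp hq =>
    by_cases h : (toricHom k w p).coeff m = 0
    · exact hq (by simpa [h] using hm)
    · exact hp h

/-- A polynomial whose exponents lie in the semigroup belongs to the semigroup ring. -/
theorem exists_incl_eq {p : Polynomial k}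
    (hp : ∀ m, p.coeff m ≠ 0 → m ∈ AddSubmonoid.closure (Set.range w)) :
    ∃ s : SemigroupRing k w, SemigroupRing.incl k w s = p := by
  have h1 : ∀ m, ∃ s : SemigroupRing k w,
      SemigroupRing.incl k w s = Polynomial.monomial m (p.coeff m) := by
    intro m
    by_cases hm : p.coeff m = 0
    · exact ⟨0, by simp [hm]⟩
    obtain ⟨α, hα⟩ := mem_closure_range_iff.1 (hp m hm)
    refine ⟨algebraMap _ _ (monomial (Finsupp.equivFunOnFinite.symm α) (p.coeff m)), ?_⟩
    rw [incl_algebraMap, toricHom_monomial, Finsupp.weight_apply,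
      Finsupp.sum_fintype _ _ (by simp)]
    simp [hα]
  choose s hs using h1
  refine ⟨∑ m ∈ p.support, s m, ?_⟩
  rw [map_sum]
  conv_rhs => rw [p.as_sum_support]
  exact Finset.sum_congr rfl fun m _ => hs m

end Ring

/-! ### `Ext¹` as `Hom` into the quotient by a nonzerodivisor -/

section Ext

/-- The isomorphism is the connecting map: `h0` makes it injective and `h1` surjective, by the long
exact sequence. -/
theorem nonempty_hom_linearEquiv_ext_one {k C : Type*} [Field k] [Category* C] [Abelian C]
    [HasExt.{u} C] [Linear k C] {S : ShortComplex C} (hS : S.ShortExact) {X : C}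
    (h0 : ∀ g : X ⟶ S.X₂, g = 0)
    (h1 : ∀ y : Abelian.Ext.{u} X S.X₁ 1, y.comp (Abelian.Ext.mk₀ S.f) (add_zero 1) = 0) :
    Nonempty ((X ⟶ S.X₃) ≃ₗ[k] Abelian.Ext.{u} X S.X₁ 1) := by
  let φ : (X ⟶ S.X₃) →ₗ[k] Abelian.Ext.{u} X S.X₁ 1 :=
    (Abelian.Ext.postcompOfLinear hS.extClass k X (zero_add 1)) ∘ₗ
      (Abelian.Ext.linearEquiv₀ (R := k)).symm.toLinearMap
  have hφ : ∀ f, φ f = (Abelian.Ext.mk₀ f).comp hS.extClass (zero_add 1) := fun f => rfl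
  refine ⟨LinearEquiv.ofBijective φ ⟨?_, fun y => ?_⟩⟩
  · rw [← LinearMap.ker_eq_bot, LinearMap.ker_eq_bot']
    intro f hf
    obtain ⟨y, hy⟩ := Abelian.Ext.covariant_sequence_exact₃ _ hS _ _ ((hφ f).symm.trans hf)
    obtain ⟨g, rfl⟩ := (Abelian.Ext.mk₀_bijective _ _).2 y
    rwa [h0 g, Abelian.Ext.mk₀_zero, Abelian.Ext.zero_comp, eq_comm,
      Abelian.Ext.mk₀_eq_zero_iff] at hy
  · obtain ⟨z, hz⟩ := Abelian.Ext.covariant_sequence_exact₁ _ hS y (h1 y) (zero_add 1)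
    obtain ⟨f, rfl⟩ := (Abelian.Ext.mk₀_bijective _ _).2 z
    exact ⟨f, hz⟩

/-- A scalar acts on `Ext` in the same way through either argument. -/
theorem comp_mk₀_smul_id_eq_zero {R C : Type*} [CommRing R] [Category* C] [Abelian C]
    [HasExt.{u} C] [Linear R C] {X Y : C} {r : R} (h : r • 𝟙 X = 0) {i : ℕ}
    (y : Abelian.Ext.{u} X Y i) :
    y.comp (Abelian.Ext.mk₀ (r • 𝟙 Y)) (add_zero i) = 0 := by
  rw [Abelian.Ext.mk₀_smul, Abelian.Ext.comp_smul, Abelian.Ext.comp_mk₀_id]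
  conv_lhs => rw [← Abelian.Ext.mk₀_id_comp y]
  rw [← Abelian.Ext.smul_comp, ← Abelian.Ext.mk₀_smul, h, Abelian.Ext.mk₀_zero,
    Abelian.Ext.zero_comp]

variable {k R : Type u} [Field k] [CommRing R]

/-- The sequence `R → R → R / (x)`, in which the first map is the multiplication by `x`. -/
noncomputable def mulShortComplex (x : R) : ShortComplex (ModuleCat.{u} R) :=
  ShortComplex.mk (X₁ := ModuleCat.of R R) (X₂ := ModuleCat.of R R)
    (X₃ := ModuleCat.of R (R ⧸ Ideal.span {x})) (x • 𝟙 _)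
    (ModuleCat.ofHom (Ideal.span {x}).mkQ) (by
      ext
      change Ideal.Quotient.mk (Ideal.span {x}) (x * 1) = 0
      rw [Ideal.Quotient.eq_zero_iff_mem, mul_one]
      exact Ideal.mem_span_singleton_self x)

theorem shortExact_mulShortComplex {x : R} (hx : x ∈ nonZeroDivisors R) :
    (mulShortComplex x).ShortExact := by
  refine ModuleCat.shortComplex_shortExact _ ?_ ?_ ?_
  · have h : ∀ y : R, Ideal.Quotient.mk (Ideal.span {x}) y = 0 ↔ ∃ z : R, x * z = y := by
      intro y
      rw [Ideal.Quotient.eq_zero_iff_mem, Ideal.mem_span_singleton]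
      exact ⟨fun ⟨z, hz⟩ => ⟨z, hz.symm⟩, fun ⟨z, hz⟩ => ⟨z, hz.symm⟩⟩
    exact h
  · have h : ∀ y z : R, x * y = x * z → y = z := fun y z =>
      (mul_cancel_left_mem_nonZeroDivisors hx).1
    exact fun y z => h y z
  · have h : Function.Surjective (Ideal.Quotient.mk (Ideal.span {x})) :=
      Ideal.Quotient.mk_surjective
    exact h

theorem nonempty_hom_linearEquiv {M N : ModuleCat.{u} R} [Algebra k R] {V : Type*} [AddCommGroup V]
    [Module k V] (ℓ : (M →ₗ[R] N) →+ V) (hℓ : ∀ c f, ℓ (algebraMap k R c • f) = c • ℓ f)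
    (hbij : Function.Bijective ℓ) : Nonempty ((M ⟶ N) ≃ₗ[k] V) := by
  let φ : (M ⟶ N) →ₗ[k] V :=
    { toFun := fun f => ℓ f.hom
      map_add' := fun f g => map_add ℓ f.hom g.hom
      map_smul' := fun c f => hℓ c f.hom }
  exact ⟨LinearEquiv.ofBijective φ (hbij.comp ModuleCat.homEquiv.bijective)⟩

theorem comp_mk₀_eq_zero_of_smul_eq_zero {M N : ModuleCat.{u} R} {r : R}
    (hM : ∀ z : M, r • z = 0) {f : N ⟶ N} (hf : ∀ z : N, f.hom z = r • z) {i : ℕ}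
    (y : Abelian.Ext.{u} M N i) : y.comp (Abelian.Ext.mk₀ f) (add_zero i) = 0 := by
  obtain rfl : f = r • 𝟙 N := ModuleCat.hom_ext (LinearMap.ext hf)
  exact comp_mk₀_smul_id_eq_zero (R := R) (C := ModuleCat.{u} R) (r := r) (X := M) (Y := N)
    (ModuleCat.hom_ext (LinearMap.ext hM)) (i := i) y

theorem finrank_ext_one {S : ShortComplex (ModuleCat.{u} R)} (hS : S.ShortExact)
    {M : ModuleCat.{u} R} [Algebra k R] (h0 : ∀ g : M ⟶ S.X₂, g = 0)
    (h1 : ∀ y : Abelian.Ext.{u} M S.X₁ 1, y.comp (Abelian.Ext.mk₀ S.f) (add_zero 1) = 0)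
    {V : Type*} [AddCommGroup V] [Module k V] (ℓ : (M →ₗ[R] S.X₃) →+ V)
    (hℓ : ∀ c f, ℓ (algebraMap k R c • f) = c • ℓ f) (hbij : Function.Bijective ℓ) :
    Module.finrank k (Abelian.Ext.{u} M S.X₁ 1) = Module.finrank k V := by
  obtain ⟨e⟩ := nonempty_hom_linearEquiv (k := k) ℓ hℓ hbij
  obtain ⟨e'⟩ := nonempty_hom_linearEquiv_ext_one (k := k) hS h0 h1
  exact (e'.symm.trans e).finrank_eq

theorem finrank_ext_one_quotient [Algebra k R] {I : Ideal R} {x : R} (hx : x ∈ nonZeroDivisors R)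
    (hxI : x ∈ I) {V : Type*} [AddCommGroup V] [Module k V]
    (ℓ : ((R ⧸ I) →ₗ[R] (R ⧸ Ideal.span {x})) →+ V)
    (hℓ : ∀ c f, ℓ (algebraMap k R c • f) = c • ℓ f) (hbij : Function.Bijective ℓ) :
    Module.finrank k (Abelian.Ext.{u} (ModuleCat.of.{u} R (R ⧸ I)) (ModuleCat.of.{u} R R) 1) =
      Module.finrank k V := by
  have hsmul : ∀ z : R ⧸ I, x • z = 0 := by
    intro z
    obtain ⟨z, rfl⟩ := Ideal.Quotient.mk_surjective z
    change Ideal.Quotient.mk I (x * z) = 0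
    exact Ideal.Quotient.eq_zero_iff_mem.2 (I.mul_mem_right _ hxI)
  have hzero : ∀ g : ModuleCat.of R (R ⧸ I) ⟶ ModuleCat.of R R, g = 0 := fun g =>
    ModuleCat.hom_ext (LinearMap.ext fun z => (mem_nonZeroDivisors_iff.1 hx).1 (g.hom z) (by
      rw [← smul_eq_mul, ← map_smul, hsmul, map_zero]))
  exact finrank_ext_one (shortExact_mulShortComplex hx) hzero
    (comp_mk₀_eq_zero_of_smul_eq_zero (f := (mulShortComplex x).f) hsmul fun z => rfl) ℓ hℓ hbij

end Ext

/-! ### The type as the number of socle exponents -/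

section CMType

variable {k : Type u} [Field k] {n : ℕ} {w : Fin n → ℕ}

theorem incl_toSemigroupRing_X (i : Fin n) :
    SemigroupRing.incl k w (toSemigroupRing k w (X i)) = Polynomial.X ^ w i :=
  aeval_X _ _

theorem toSemigroupRing_X_mem_nonZeroDivisors (i : Fin n) :
    toSemigroupRing k w (X i) ∈ nonZeroDivisors (SemigroupRing k w) := by
  rw [mem_nonZeroDivisors_iff_right]
  intro y hy
  have h := congrArg (SemigroupRing.incl k w) hy
  rw [map_mul, incl_toSemigroupRing_X, map_zero] at h
  refine incl_injective ?_
  rw [map_zero]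
  exact (mul_eq_zero.1 h).resolve_right (pow_ne_zero _ Polynomial.X_ne_zero)

theorem mem_span_toSemigroupRing_X_iff (i : Fin n) (r : SemigroupRing k w) :
    r ∈ Ideal.span {toSemigroupRing k w (X i)} ↔
      ∀ m, (SemigroupRing.incl k w r).coeff m ≠ 0 → m ∈ semigroupTranslate w (w i) := by
  rw [Ideal.mem_span_singleton]
  constructor
  · rintro ⟨s, rfl⟩ m hm
    rw [map_mul, incl_toSemigroupRing_X, Polynomial.coeff_X_pow_mul'] at hm
    split_ifs at hm with hle
    · exact ⟨m - w i, support_incl_subset s hm, by omega⟩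
    · exact absurd rfl hm
  · intro h
    have hdvd : Polynomial.X ^ w i ∣ SemigroupRing.incl k w r := by
      rw [Polynomial.X_pow_dvd_iff]
      intro d hd
      by_contra hne
      obtain ⟨s, -, hs⟩ := h d hne
      omega
    obtain ⟨p, hp⟩ := hdvd
    obtain ⟨s, hs⟩ := exists_incl_eq (w := w) (p := p) (fun m hm => by
      have h1 : (SemigroupRing.incl k w r).coeff (m + w i) ≠ 0 := by
        rwa [hp, Polynomial.coeff_X_pow_mul]
      obtain ⟨s, hs, he⟩ := h _ h1
      obtain rfl : m = s := by omega
      exact hs)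
    exact ⟨s, incl_injective (by rw [hp, map_mul, incl_toSemigroupRing_X, hs])⟩

/-- The coefficients of an element of the semigroup ring at the exponents in a set. -/
noncomputable def coeffOn (P : Set ℕ) (r : SemigroupRing k w) : P →₀ k :=
  (Polynomial.basisMonomials k).repr (SemigroupRing.incl k w r) |>.subtypeDomain (· ∈ P)

theorem coeffOn_apply (P : Set ℕ) (r : SemigroupRing k w) (m : P) :
    coeffOn P r m = (SemigroupRing.incl k w r).coeff m := rfl

theorem exists_coeffOn_eq {P : Set ℕ} (hP : ∀ m ∈ P, m ∈ AddSubmonoid.closure (Set.range w))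
    (v : P →₀ k) : ∃ r : SemigroupRing k w, coeffOn P r = v ∧
      ∀ m, (SemigroupRing.incl k w r).coeff m ≠ 0 → m ∈ P := by
  classical
  let p : Polynomial k := ∑ m ∈ v.support, Polynomial.monomial (m : ℕ) (v m)
  have hp : ∀ m, p.coeff m = if h : m ∈ P then v ⟨m, h⟩ else 0 := by
    intro m
    simp only [p, Polynomial.finsetSum_coeff, Polynomial.coeff_monomial]
    split_ifs with h
    · rw [Finset.sum_eq_single ⟨m, h⟩]
      · simp
      · intro b _ hb
        rw [if_neg fun h' => hb (Subtype.ext h')]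
      · intro h'
        simpa using h'
    · refine Finset.sum_eq_zero fun b _ => ?_
      rw [if_neg]
      rintro rfl
      exact h b.2
  have hp' : ∀ m, p.coeff m ≠ 0 → m ∈ P := by
    intro m hm
    by_contra h
    exact hm (by rw [hp, dif_neg h])
  obtain ⟨r, hr⟩ := exists_incl_eq (w := w) (p := p) fun m hm => hP m (hp' m hm)
  refine ⟨r, ?_, fun m hm => hp' m (hr ▸ hm)⟩
  ext m
  rw [coeffOn_apply, hr, hp, dif_pos m.2]

theorem coeffOn_eq_of_sub_mem {i : Fin n} {r s : SemigroupRing k w}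
    (h : r - s ∈ Ideal.span {toSemigroupRing k w (X i)}) :
    coeffOn (socleExponents w (w i)) r = coeffOn (socleExponents w (w i)) s := by
  ext m
  rw [coeffOn_apply, coeffOn_apply]
  by_contra hne
  refine m.2.2.1 ((mem_span_toSemigroupRing_X_iff i _).1 h m ?_)
  rwa [map_sub, Polynomial.coeff_sub, sub_ne_zero]

/-- A map from `S / 𝔪` to `S / (x)` is determined by the image of `1`, a socle element, and that
element by its coefficients at the socle exponents. -/
theorem cmType_eq_card_socleExponents (i : Fin n) :
    cmType k w = Nat.card (socleExponents w (w i)) := by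
  set P := socleExponents w (w i) with hP
  set x := toSemigroupRing k w (X i) with hx
  -- The chosen representative is immaterial: elements of `(x)` have no coefficients at socle
  -- exponents.
  let κ : (SemigroupRing k w ⧸ Ideal.span {x}) → (P →₀ k) :=
    fun q => coeffOn P (Quotient.out q)
  have hκ : ∀ r, κ (Ideal.Quotient.mk _ r) = coeffOn P r := fun r =>
    coeffOn_eq_of_sub_mem (Ideal.Quotient.eq.1 (Quotient.out_eq _))
  have hκadd : ∀ q q', κ (q + q') = κ q + κ q' := by
    intro q q'
    obtain ⟨r, rfl⟩ := Ideal.Quotient.mk_surjective q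
    obtain ⟨r', rfl⟩ := Ideal.Quotient.mk_surjective q'
    rw [← map_add, hκ, hκ, hκ]
    ext m
    simp [coeffOn_apply]
  let ℓ : ((SemigroupRing k w ⧸ maxIdeal k w) →ₗ[SemigroupRing k w]
      (SemigroupRing k w ⧸ Ideal.span {x})) →+ (P →₀ k) :=
    AddMonoidHom.mk' (fun f => κ (f 1)) fun f g => hκadd _ _
  have hℓ : ∀ f, ℓ f = κ (f 1) := fun f => rfl
  have hgen : ∀ j, toSemigroupRing k w (X j) ∈ maxIdeal k w := fun j =>
    Ideal.subset_span ⟨j, rfl⟩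
  have hcoeff : ∀ (j : Fin n) (r : SemigroupRing k w) (m : ℕ),
      (SemigroupRing.incl k w (toSemigroupRing k w (X j) * r)).coeff (m + w j) =
        (SemigroupRing.incl k w r).coeff m := fun j r m => by
    rw [map_mul, incl_toSemigroupRing_X, Polynomial.coeff_X_pow_mul]
  refine (finrank_ext_one_quotient (toSemigroupRing_X_mem_nonZeroDivisors i) (hgen i) ℓ
    ?_ ⟨?_, ?_⟩).trans ?_
  · intro c f
    rw [hℓ, hℓ, LinearMap.smul_apply]
    obtain ⟨r, hr⟩ := Ideal.Quotient.mk_surjective (f 1)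
    rw [← hr, hκ]
    refine (hκ (algebraMap k _ c * r)).trans ?_
    ext m
    simp [coeffOn_apply]
  · rw [injective_iff_map_eq_zero]
    intro f hf
    obtain ⟨r, hr⟩ := Ideal.Quotient.mk_surjective (f 1)
    have hsmul : ∀ z : SemigroupRing k w,
        f (Ideal.Quotient.mk _ z) = Ideal.Quotient.mk _ (z * r) := fun z => by
      refine Eq.trans ?_ (congrArg (z • ·) hr.symm)
      change _ = z • f 1
      rw [← map_smul]
      congr 1
      change _ = Ideal.Quotient.mk _ (z * 1)
      rw [mul_one]
    rw [hℓ, ← hr, hκ] at hf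
    -- An exponent of `r` outside the translate would be a socle exponent, since every `t ^ wⱼ * r`
    -- lies in `(x)`; but there `r` has coefficient zero.
    have hr0 : r ∈ Ideal.span {x} := by
      rw [hx, mem_span_toSemigroupRing_X_iff]
      intro m hm
      by_contra hmt
      refine hm (DFunLike.congr_fun hf ⟨m, support_incl_subset r hm, hmt, fun j => ?_⟩)
      refine (mem_span_toSemigroupRing_X_iff i (toSemigroupRing k w (X j) * r)).1 ?_ _
        (by rwa [hcoeff])
      rw [← Ideal.Quotient.eq_zero_iff_mem, ← hsmul, Ideal.Quotient.eq_zero_iff_mem.2 (hgen j),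
        map_zero]
    refine LinearMap.ext fun z => ?_
    obtain ⟨z, rfl⟩ := Ideal.Quotient.mk_surjective z
    rw [hsmul, LinearMap.zero_apply, Ideal.Quotient.eq_zero_iff_mem]
    exact Ideal.mul_mem_left _ _ hr0
  · intro v
    obtain ⟨r, hr, hrP⟩ := exists_coeffOn_eq (fun m (hm : m ∈ P) => hm.1) v
    let g : SemigroupRing k w →ₗ[SemigroupRing k w] (SemigroupRing k w ⧸ Ideal.span {x}) :=
      LinearMap.toSpanSingleton _ _ (Ideal.Quotient.mk _ r)
    have hg : maxIdeal k w ≤ LinearMap.ker g := by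
      refine Ideal.span_le.2 ?_
      rintro _ ⟨j, rfl⟩
      change Ideal.Quotient.mk _ (toSemigroupRing k w (X j) * r) = 0
      rw [Ideal.Quotient.eq_zero_iff_mem, hx, mem_span_toSemigroupRing_X_iff]
      intro m hm
      have hle : w j ≤ m := by
        by_contra hlt
        rw [map_mul, incl_toSemigroupRing_X, Polynomial.coeff_X_pow_mul', if_neg hlt] at hm
        exact hm rfl
      obtain ⟨m, rfl⟩ := Nat.exists_eq_add_of_le' hle
      rw [hcoeff] at hm
      exact (hrP m hm).2.2 j
    refine ⟨Submodule.liftQ _ g hg, ?_⟩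
    rw [hℓ, ← hr, ← hκ]
    congr 1
    change Ideal.Quotient.mk _ (1 * r) = _
    rw [one_mul]
  -- Both sides are `Cardinal.toNat` of the same cardinal, so finiteness of the set is not needed.
  · rw [Module.finrank, rank_finsupp_self, Cardinal.toNat_lift]
    rfl

end CMType

end SimpleSplit

theorem theorem4p1 (k : Type u) [Field k] {n : ℕ} (a : Fin n → ℕ) (k₁ k₂ : ℕ)
    (hsplit : SimpleSplit.IsSimpleSplit a k₁ k₂) :
    (∃ α : Fin n → ℕ, k₁ = ∑ i, α i * a i) ∧
    (∀ (α : Fin n → ℕ) (hα : k₁ = ∑ i, α i * a i)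
      (F : SimpleSplit.GradedFreeComplex k a), F.IsMinimalResolution →
        (SimpleSplit.splitCone F k₁ k₂ α hα).IsMinimalResolution) ∧
    (∃ βA βC : ℤ → ℕ,
      SimpleSplit.HasBettiNumbers k a βA ∧
      SimpleSplit.HasBettiNumbers k (SimpleSplit.splitGens a k₁ k₂) βC ∧
      ∀ i, βC i = βA i + βA (i - 1)) ∧
    SimpleSplit.cmType k (SimpleSplit.splitGens a k₁ k₂) = SimpleSplit.cmType k a := by
  have hcone := fun (α : Fin n → ℕ) (hα : k₁ = ∑ i, α i * a i)
    (F : SimpleSplit.GradedFreeComplex k a) (hF : F.IsMinimalResolution) =>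
      SimpleSplit.isMinimalResolution_splitCone hsplit.k₁_pos hsplit.k₂_pos hsplit.coprime α hα hF
  obtain ⟨α, hα⟩ := SimpleSplit.mem_closure_range_iff.1 hsplit.k₁_mem
  obtain ⟨F, hF⟩ := SimpleSplit.exists_isMinimalResolution k hsplit.gens.pos
  refine ⟨⟨α, hα⟩, hcone, ⟨F.rank, (SimpleSplit.splitCone F k₁ k₂ α hα).rank,
    ⟨⟨F, hF⟩, fun G hG i => by rw [hG.rank_eq hF]⟩,
    ⟨⟨_, hcone α hα F hF⟩, fun G hG i => by rw [hG.rank_eq (hcone α hα F hF)]⟩, ?_⟩, ?_⟩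
  · intro i
    match i with
    | Int.ofNat 0 => rfl
    | Int.ofNat (i + 1) =>
      have h : (Int.ofNat (i + 1) - 1 : ℤ) = Int.ofNat i := by simp
      rw [h]
      exact Fintype.card_sum (α := F.ι (i + 1)) (β := F.ι i)
    | Int.negSucc i => rfl
  -- The gcd of the empty family is `0`.
  · obtain ⟨i⟩ : Nonempty (Fin n) := by
      by_contra h
      rw [not_nonempty_iff] at h
      simpa using hsplit.gens.gcd_eq_one
    rw [SimpleSplit.cmType_eq_card_socleExponents i, SimpleSplit.cmType_eq_card_socleExponents
      (w := SimpleSplit.splitGens a k₁ k₂) i.succ]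
    have hs : SimpleSplit.splitGens a k₁ k₂ i.succ = k₂ * a i := by simp [SimpleSplit.splitGens]
    rw [hs]
    exact (Nat.card_congr ((SimpleSplit.bijOn_socleExponents hsplit.k₂_pos hsplit.k₁_pos
      hsplit.coprime hsplit.k₁_mem (a i)).equiv _)).symm
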